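/- For a positive integer $n$ let $\log^* n$ be the number of times the base-2 logarithm must be applied to $n$ until the value is at most $1$. An input to the MIS-reconfiguration problem is a finite graph $G=(V,E)$ with two maximal independent sets $\alpha,\beta$ of $G$. A reconfiguration schedule of length $\ell$ with $d$-domination is a sequence $S_0,\dots,S_\ell$ of subsets of $V$ such that $S_0=\alpha$, $S_\ell=\beta$; for every $0<i<\ell$ the set $S_i$ is independent and every node is within distance at most $d$ of $S_i$; and for every $0<i\le\ell$ the symmetric difference $S_i\oplus S_{i-1}$ is independent. We use the deterministic LOCAL model: in each synchronous round every node exchanges messages of unbounded size with its neighbours. The nodes have distinct identifiers from $\{1,\dots,n^a\}$, where $n=|V|$ and $a\ge 1$ is a constant; each node initially knows $n$, its own identifier and whether it belongs to $\alpha$ and to $\beta$; each message is addressed to a neighbour by identifier and carries the identifier of its sender. To find a schedule in $T$ rounds means that after $T$ rounds each node outputs its membership in each of $S_0,\dots,S_\ell$, for all assignments of identifiers. **Corollary.** For all fixed integers $k\ge 2$ and $d\ge 4$ there is a class $\mathcal C$ of connected $k$-regular inputs $(G,\alpha,\beta)$, containing inputs with arbitrarily many nodes, on which finding a constant-length reconfiguration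 schedule with $d$-domination takes $\Theta(\log^* n)$ rounds. That is: 1. There is a constant $\ell$ such that for every $a\ge1$ there are a constant $C$ and an algorithm that, on every $n$-node input in $\mathcal C$ and for all identifiers from $\{1,\dots,n^a\}$, finds a schedule of length at most $\ell$ with $d$-domination in at most $C\log^* n$ rounds. 2. For every constant $\ell$ and every $a\ge1$ there are constants $c>0$ and $n_0$ such that for every $n\ge n_0$ for which $\mathcal C$ contains an $n$-node input, every algorithm that finds a schedule of length at most $\ell$ with $d$-domination in $T$ rounds on all $n$-node inputs in $\mathcal C$, for all identifiers from $\{1,\dots,n^a\}$, satisfies $T\ge c\log^* n$. -/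

import Mathlib

open scoped symmDiff

/-- The iterated logarithm `log* n`: the number of times the base-2 logarithm has to be applied,
starting from `n`, until the value is at most `1`. -/
noncomputable def logStar (n : ℕ) : ℕ :=
  sInf {i : ℕ | (Real.logb 2)^[i] (n : ℝ) ≤ 1}

namespace MISReconf

/-- `U` is a maximal independent set (MIS) of `G`. -/
def IsMIS {V : Type*} (G : SimpleGraph V) (U : Set V) : Prop :=
  Maximal G.IsIndepSet U

/-- `U` is a `d`-dominating set of `G`: every node is at distance at most `d` from some node
of `U`. (`edist` is infinite between different components.) -/
def IsDominating {V : Type*} (G : SimpleGraph V) (d : ℕ) (U : Set V) : Prop :=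
  ∀ v, ∃ u ∈ U, G.edist v u ≤ (d : ℕ∞)

/-- `S 0, …, S ℓ` is an `(α, β, P)`-reconfiguration schedule of length `ℓ` on `G`, for the
property `P` of being an independent `d`-dominating set (a `(2, d)`-ruling set). The values
`S i` with `i > ℓ` play no role. -/
structure IsSchedule {V : Type*} (G : SimpleGraph V) (α β : Set V) (d ℓ : ℕ)
    (S : ℕ → Set V) : Prop where
  first : S 0 = α
  last : S ℓ = β
  indep : ∀ i, 0 < i → i < ℓ → G.IsIndepSet (S i)
  dominating : ∀ i, 0 < i → i < ℓ → IsDominating G d (S i)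
  step : ∀ i, i < ℓ → G.IsIndepSet (S (i + 1) ∆ S i)

/-- An `n`-node input to the MIS-reconfiguration problem: a graph with an initial MIS `α` and a
final MIS `β`. -/
structure Input (n : ℕ) where
  G : SimpleGraph (Fin n)
  α : Set (Fin n)
  β : Set (Fin n)
  isMIS_α : IsMIS G α
  isMIS_β : IsMIS G β

open scoped Classical in
/-- The input graph is a connected `k`-regular graph. -/
def Input.IsConnectedRegular {n : ℕ} (I : Input n) (k : ℕ) : Prop :=
  I.G.Connected ∧ I.G.IsRegularOfDegree k

/-- A deterministic algorithm in the LOCAL model for the MIS-reconfiguration problem. States and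
messages are unrestricted. Initially a node knows the number `n` of nodes, its own identifier, and
whether it belongs to `α` and to `β`. In each round it sends to each neighbour a message, which may
depend on the identifier of that neighbour, and then updates its state according to the messages
received, each labelled with the identifier of its sender. The output of a node is the list of bits
that tell whether the node belongs to `S 0`, to `S 1`, and so on. -/
structure LocalAlgorithm where
  State : Type
  Msg : Type
  init : (n : ℕ) → (ident : ℕ) → (inα inβ : Bool) → State
  send : State → (receiver : ℕ) → Msg
  receive : State → (inbox : ℕ → Option Msg) → State
  output : State → List Bool

/-- A valid assignment of identifiers: distinct numbers in `{1, …, n ^ a}`. -/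
def IsIdentAssignment (n a : ℕ) (ident : Fin n → ℕ) : Prop :=
  Function.Injective ident ∧ ∀ v, 1 ≤ ident v ∧ ident v ≤ n ^ a

open scoped Classical in
/-- What node `v` receives in a round if every node `u` sends `msg u j` to its neighbour with
identifier `j`: at index `j` there is the message from the neighbour of `v` with identifier `j`,
if `v` has such a neighbour. -/
noncomputable def inbox {n : ℕ} {M : Type} (G : SimpleGraph (Fin n)) (ident : Fin n → ℕ)
    (msg : Fin n → ℕ → M) (v : Fin n) (j : ℕ) : Option M :=
  if h : ∃ u, G.Adj v u ∧ ident u = j then some (msg h.choose (ident v)) else none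

open scoped Classical in
/-- The state of each node after a given number of synchronous rounds. -/
noncomputable def LocalAlgorithm.stateAfter (A : LocalAlgorithm) {n : ℕ} (I : Input n)
    (ident : Fin n → ℕ) : ℕ → Fin n → A.State
  | 0, v => A.init n (ident v) (decide (v ∈ I.α)) (decide (v ∈ I.β))
  | t + 1, v => A.receive (A.stateAfter I ident t v)
      (inbox I.G ident (fun u => A.send (A.stateAfter I ident t u)) v)

/-- With the given identifiers, after `T` rounds on the input `I` the nodes output a
reconfiguration schedule of some length `L ≤ ℓ` whose intermediate sets are independent and
`d`-dominating. -/
def LocalAlgorithm.FindsSchedule (A : LocalAlgorithm) {n : ℕ} (I : Input n)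
    (ident : Fin n → ℕ) (d ℓ T : ℕ) : Prop :=
  ∃ L ≤ ℓ, (∀ v, (A.output (A.stateAfter I ident T v)).length = L + 1) ∧
    IsSchedule I.G I.α I.β d L
      (fun i => {v | (A.output (A.stateAfter I ident T v)).getD i false = true})

/-- On all `n`-node inputs in `𝒞`, and for all assignments of identifiers from `{1, …, n ^ a}`, the
algorithm finds in `T` rounds a schedule of length at most `ℓ` with `d`-domination. -/
def LocalAlgorithm.SolvesIn (A : LocalAlgorithm) {n : ℕ} (𝒞 : Set (Input n))
    (a d ℓ T : ℕ) : Prop :=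
  ∀ I ∈ 𝒞, ∀ ident : Fin n → ℕ, IsIdentAssignment n a ident → A.FindsSchedule I ident d ℓ T

end MISReconf

/-! The inputs are rings of `m ≥ 3` blocks, each a complete bipartite graph on two sides of `r + 1`
nodes with `r = k - 2`, consecutive blocks being joined by a perfect matching; `α` and `β` are the
two sides of the bipartition. For `k = 2` these are even cycles.

Upper bound. Let `X ⊆ β` be maximal such that no two of its nodes are joined by a walk of length
four. Then `β` can replace `α` in six steps, growing from `X`, where each step changes nodes of one
side only (`isSchedule_growSchedule`). The delicate point is that `α` without the neighbours of `X`
still dominates; this holds because no two nodes of `β` are twins (`isNear_sdiff_nbrs`). Such an `X`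
is obtained greedily, colour class by colour class, from a colouring with boundedly many colours,
and iterated colour reduction yields one in `O(log* n)` rounds (`exists_colorReduction`,
`exists_numBits_le`).

Lower bound. Let block numbers, which determine the identifiers, increase along an arc. After `T`
rounds the pattern of a block (which sides meet which `S t`) depends only on `2 * T + 1` consecutive
block numbers. The pattern cannot be constant on `2 * d + 1` consecutive blocks
(`IsRing.not_const_of_isSchedule`): a complete bipartite block cannot change sides in one step, and
it cannot become empty since domination would fail in the middle block. Hence windows of patterns
properly colour a shift graph with a bounded number of colours, which forces `m ≤ tower (2 * T +
O(1))` (`le_tower_of_shift_ne`). -/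

namespace MISReconf

/-! ### Towers and the iterated logarithm -/

/-- The tower function: a stack of `i` twos. -/
def tower : ℕ → ℕ
  | 0 => 1
  | i + 1 => 2 ^ tower i

lemma tower_lt_succ (i : ℕ) : tower i < tower (i + 1) := Nat.lt_two_pow_self

lemma tower_strictMono : StrictMono tower := strictMono_nat_of_lt_succ tower_lt_succ

lemma one_le_tower (i : ℕ) : 1 ≤ tower i := tower_strictMono.monotone (Nat.zero_le i)

lemma le_tower (i : ℕ) : i ≤ tower i := tower_strictMono.le_apply

lemma two_mul_tower_le (i : ℕ) : 2 * tower i ≤ tower (i + 1) := by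
  have h : tower i ≤ 2 ^ (tower i - 1) := by
    have := Nat.lt_two_pow_self (n := tower i - 1)
    omega
  have h1 := one_le_tower i
  calc 2 * tower i ≤ 2 * 2 ^ (tower i - 1) := by omega
    _ = 2 ^ (tower i - 1 + 1) := by ring
    _ = tower (i + 1) := by rw [Nat.sub_add_cancel h1]; rfl

lemma mul_tower_le (c i : ℕ) : c * tower i ≤ tower (i + c) := by
  have h : ∀ r, 2 ^ r * tower i ≤ tower (i + r) := by
    intro r
    induction r with
    | zero => simp
    | succ r ih =>
      calc 2 ^ (r + 1) * tower i = 2 * (2 ^ r * tower i) := by ring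
        _ ≤ 2 * tower (i + r) := by omega
        _ ≤ tower (i + (r + 1)) := two_mul_tower_le _
  exact (Nat.mul_le_mul_right _ Nat.lt_two_pow_self.le).trans (h c)

lemma exists_iterate_logb_le_one (i : ℕ) (x : ℝ) (hx : x ≤ tower i) :
    ∃ j ≤ i, (Real.logb 2)^[j] x ≤ 1 := by
  induction i generalizing x with
  | zero => exact ⟨0, le_rfl, by simpa [tower] using hx⟩
  | succ i ih =>
    -- Iteration stops here: `Real.logb` of a negative number is the logarithm of its absolute
    -- value, so a later iterate could exceed 1 again. Hence `j ≤ i` instead of `j = i`.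
    by_cases h1 : x ≤ 1
    · exact ⟨0, Nat.zero_le _, h1⟩
    · push Not at h1
      obtain ⟨j, hj, hle⟩ := ih (Real.logb 2 x) (by
        rw [Real.logb_le_iff_le_rpow (by norm_num) (by linarith)]
        simpa [tower] using hx)
      exact ⟨j + 1, by omega, hle⟩

lemma logStar_le_of_le_tower {n i : ℕ} (h : n ≤ tower i) : logStar n ≤ i := by
  obtain ⟨j, hj, hle⟩ := exists_iterate_logb_le_one i (n : ℝ) (by exact_mod_cast h)
  exact (Nat.sInf_le hle).trans hj

lemma iterate_logStar_le_one (n : ℕ) : (Real.logb 2)^[logStar n] (n : ℝ) ≤ 1 := by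
  obtain ⟨j, -, hle⟩ := exists_iterate_logb_le_one n (n : ℝ) (by exact_mod_cast le_tower n)
  exact Nat.sInf_mem (s := {i : ℕ | (Real.logb 2)^[i] (n : ℝ) ≤ 1}) ⟨j, hle⟩

lemma one_lt_iterate_logb (i : ℕ) (x : ℝ) (hx : tower i < x) :
    ∀ j ≤ i, 1 < (Real.logb 2)^[j] x := by
  induction i generalizing x with
  | zero =>
    intro j hj
    obtain rfl : j = 0 := by omega
    simpa [tower] using hx
  | succ i ih =>
    intro j hj
    have h1 : (1 : ℝ) ≤ tower (i + 1) := by exact_mod_cast one_le_tower (i + 1)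
    cases j with
    | zero => exact h1.trans_lt hx
    | succ j =>
      refine ih (Real.logb 2 x) ?_ j (by omega)
      rw [Real.lt_logb_iff_rpow_lt (by norm_num) (by linarith)]
      simpa [tower] using hx

lemma lt_logStar_of_tower_lt {n i : ℕ} (h : tower i < n) : i < logStar n := by
  by_contra hlt
  push Not at hlt
  have h1 := one_lt_iterate_logb i n (by exact_mod_cast h) _ hlt
  exact absurd (iterate_logStar_le_one n) (not_le.mpr h1)

/-! ### Colour lengths under iterated reduction -/

/-- The number of bits after each step of the colour reduction, starting from identifiers
in `{1, …, n ^ a}`, in a graph in which each node has to avoid `Δ` colours. -/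
def numBits (Δ a n : ℕ) : ℕ → ℕ
  | 0 => a * (Nat.log 2 n + 1)
  | i + 1 => Δ * (Nat.log 2 (numBits Δ a n i) + 2)

lemma natLog_le_logb {x : ℕ} (hx : x ≠ 0) : (Nat.log 2 x : ℝ) ≤ Real.logb 2 x := by
  rw [Real.le_logb_iff_rpow_le (by norm_num) (by positivity)]
  exact_mod_cast Nat.pow_log_le_self 2 hx

/-- Since the logarithm is `o(x)`, some `M` absorbs all constants of the recursion for `numBits`. -/
lemma exists_mul_logb_le (Δ a : ℝ) :
    ∃ M : ℝ, 1 ≤ M ∧ 2 * a ≤ M ∧ Δ * (Real.logb 2 M + 3) ≤ M := by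
  have h := (Real.isLittleO_log_id_atTop.const_mul_left (Δ / Real.log 2)).def
    (show (0 : ℝ) < 1 / 2 by norm_num)
  obtain ⟨M, h1, h2, h3, h4⟩ := (h.and ((Filter.eventually_ge_atTop 1).and
    ((Filter.eventually_ge_atTop (2 * a)).and (Filter.eventually_ge_atTop (6 * Δ))))).exists
  refine ⟨M, h2, h3, ?_⟩
  simp only [id, Real.norm_eq_abs, abs_of_nonneg (zero_le_one.trans h2)] at h1
  have h5 := (le_abs_self _).trans h1
  have h6 : Δ * Real.logb 2 M = Δ / Real.log 2 * Real.log M := by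
    rw [Real.logb]; ring
  linarith [h6]

lemma numBits_pos {Δ a : ℕ} (hΔ : 1 ≤ Δ) (ha : 1 ≤ a) (n i : ℕ) : 1 ≤ numBits Δ a n i := by
  cases i <;> simp only [numBits] <;> exact Nat.mul_pos (by omega) (by omega)

/-- The length after `i` steps is at most `M` times the `(i + 1)`-st iterated logarithm of `n`, cut
off below at 2. The start already costs one logarithm, whence `logStar n - 1` steps. -/
lemma exists_numBits_le {Δ a : ℕ} (hΔ : 1 ≤ Δ) (ha : 1 ≤ a) :
    ∃ B : ℕ, ∀ n, 2 ≤ n → numBits Δ a n (logStar n - 1) ≤ B := by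
  obtain ⟨M, hM1, hMa, hMΔ⟩ := exists_mul_logb_le Δ a
  refine ⟨⌈M * 2⌉₊, fun n hn => ?_⟩
  have hn' : (2 : ℝ) ≤ n := by exact_mod_cast hn
  have key : ∀ i, (numBits Δ a n i : ℝ) ≤ M * max ((Real.logb 2)^[i + 1] (n : ℝ)) 2 := by
    intro i
    induction i with
    | zero =>
      have h1 : 1 ≤ Real.logb 2 n := by
        rw [Real.le_logb_iff_rpow_le (by norm_num) (by linarith)]; simpa using hn'
      have h2 := natLog_le_logb (x := n) (by omega)
      have h3 : (0 : ℝ) ≤ a := by positivity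
      calc (numBits Δ a n 0 : ℝ) = a * (Nat.log 2 n + 1) := by simp [numBits]
        _ ≤ a * (2 * Real.logb 2 n) := by gcongr; linarith
        _ = 2 * a * Real.logb 2 n := by ring
        _ ≤ M * Real.logb 2 n := by gcongr
        _ ≤ M * max (Real.logb 2 n) 2 := by gcongr; exact le_max_left _ _
    | succ i ih =>
      rw [Function.iterate_succ_apply']
      set z := (Real.logb 2)^[i + 1] (n : ℝ)
      have hpos := numBits_pos hΔ ha n i
      have hy : (2 : ℝ) ≤ max z 2 := le_max_right _ _
      have hlogy : 1 ≤ Real.logb 2 (max z 2) := by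
        rw [Real.le_logb_iff_rpow_le (by norm_num) (by linarith)]; simp
      have h1 : (Nat.log 2 (numBits Δ a n i) : ℝ) ≤ Real.logb 2 M + Real.logb 2 (max z 2) := by
        refine (natLog_le_logb (by omega)).trans ?_
        rw [← Real.logb_mul (by linarith) (by linarith)]
        exact Real.logb_le_logb_of_le (by norm_num) (by exact_mod_cast hpos) ih
      have hlogM : 0 ≤ Real.logb 2 M := Real.logb_nonneg (by norm_num) hM1
      have h2 : Real.logb 2 (max z 2) ≤ max (Real.logb 2 z) 2 := by
        rcases le_total z 2 with h | h
        · rw [max_eq_right h, Real.logb_self_eq_one (by norm_num)]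
          exact one_le_two.trans (le_max_right _ _)
        · rw [max_eq_left h]; exact le_max_left _ _
      calc (numBits Δ a n (i + 1) : ℝ) = Δ * (Nat.log 2 (numBits Δ a n i) + 2) := by
            simp [numBits]
        _ ≤ Δ * ((Real.logb 2 M + 3) * Real.logb 2 (max z 2)) := by
            gcongr
            nlinarith
        _ = Δ * (Real.logb 2 M + 3) * Real.logb 2 (max z 2) := by ring
        _ ≤ M * max (Real.logb 2 z) 2 := by gcongr
  have hpos : 0 < logStar n := lt_logStar_of_tower_lt (i := 0) (by simp only [tower]; omega)
  have h := key (logStar n - 1)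
  rw [Nat.sub_add_cancel hpos,
    max_eq_right ((iterate_logStar_le_one n).trans one_le_two)] at h
  exact_mod_cast h.trans (Nat.le_ceil _)

/-! ### Colourings of shift graphs -/

/-- A function of the first `K` entries of an increasing sequence of numbers below `N` which always
changes when the sequence is shifted needs many values: the shift graph has large chromatic
number. -/
lemma le_tower_of_shift_ne (K : ℕ) : ∀ (q N : ℕ) (X : Type) [Finite X] (f : (ℕ → ℕ) → X),
    Nat.card X ≤ tower q →
    (∀ s s', (∀ i ≤ K, s i = s' i) → f s = f s') →
    (∀ s, StrictMonoOn s (Set.Iic (K + 1)) → (∀ i ≤ K + 1, s i < N) →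
      f s ≠ f (fun i => s (i + 1))) →
    N ≤ tower (q + K) := by
  induction K with
  | zero =>
    intro q N X _ f hX hloc hne
    have hlt : ∀ i j : ℕ, i < j → j < N → f (fun _ => i) ≠ f (fun _ => j) := by
      intro i j hij hj
      have h := hne (fun t => if t = 0 then i else j) (by
          intro a ha b hb hab
          simp only [Set.mem_Iic] at ha hb
          obtain rfl : a = 0 := by omega
          obtain rfl : b = 1 := by omega
          simpa using hij) (by intro t _; split_ifs <;> omega)
      rwa [hloc _ (fun _ => i) (by intro t ht; simp [Nat.le_zero.mp ht])] at h
    have hinj : Function.Injective (fun i : Fin N => f (fun _ => (i : ℕ))) := by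
      intro i j hij
      rcases lt_trichotomy i j with h | h | h
      · exact absurd hij (hlt _ _ h j.2)
      · exact h
      · exact absurd hij.symm (hlt _ _ h i.2)
    simpa using (Nat.card_le_card_of_injective _ hinj).trans hX
  | succ K ih =>
    intro q N X _ f hX hloc hne
    -- A shorter sequence is coloured with the set of colours of its one-entry extensions, at the
    -- cost of one exponential. If this set were unchanged by the shift, `f s` would be the colour
    -- of some `t` extending the shift of `s`; prepending `s 0` to `t` then contradicts `hne`.
    have h := ih (q + 1) N (Set X)
      (fun s => {x | ∃ s' : ℕ → ℕ, (∀ i ≤ K, s' i = s i) ∧ StrictMonoOn s' (Set.Iic (K + 1)) ∧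
        (∀ i ≤ K + 1, s' i < N) ∧ f s' = x}) ?_ ?_ ?_
    · rwa [add_right_comm] at h
    · classical
      cases nonempty_fintype X
      rw [Nat.card_eq_fintype_card, Fintype.card_set]
      rw [Nat.card_eq_fintype_card] at hX
      exact Nat.pow_le_pow_right (by norm_num) hX
    · intro s s' hs
      ext x
      refine exists_congr fun t => and_congr_left' (forall₂_congr fun i hi => ?_)
      rw [hs i hi]
    · intro s hs hN heq
      have hmem : f s ∈ {x | ∃ s' : ℕ → ℕ, (∀ i ≤ K, s' i = s i) ∧
          StrictMonoOn s' (Set.Iic (K + 1)) ∧ (∀ i ≤ K + 1, s' i < N) ∧ f s' = x} :=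
        ⟨s, fun _ _ => rfl, hs, hN, rfl⟩
      rw [heq] at hmem
      obtain ⟨t, ht, htm, htN, hft⟩ := hmem
      have hne' := hne (fun i => Nat.casesOn i (s 0) t) ?_ ?_
      · refine hne' (Eq.trans ?_ hft.symm)
        refine hloc _ _ fun i hi => ?_
        cases i with
        | zero => rfl
        | succ i => exact ht i (by omega)
      · intro i hi j hj hij
        simp only [Set.mem_Iic] at hi hj
        obtain ⟨j, rfl⟩ : ∃ j', j = j' + 1 := ⟨j - 1, by omega⟩
        cases i with
        | zero =>
          have h0 : s 0 < t 0 := by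
            rw [ht 0 (Nat.zero_le _)]
            exact hs (by simp) (by simp) (by omega)
          exact h0.trans_le (htm.monotoneOn (by simp) (by simp; omega) (Nat.zero_le j))
        | succ i => exact htm (by simp; omega) (by simp; omega) (by omega)
      · intro i hi
        cases i with
        | zero => exact hN 0 (Nat.zero_le _)
        | succ i => exact htN i (by omega)

/-! ### Message passing and indistinguishability -/

lemma inbox_eq_some {n : ℕ} {M : Type} (G : SimpleGraph (Fin n)) {ident : Fin n → ℕ}
    (hid : Function.Injective ident) (msg : Fin n → ℕ → M) {v u : Fin n} (h : G.Adj v u) :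
    inbox G ident msg v (ident u) = some (msg u (ident v)) := by
  have hex : ∃ w, G.Adj v w ∧ ident w = ident u := ⟨u, h, rfl⟩
  rw [inbox, dif_pos hex, hid hex.choose_spec.2]

lemma inbox_eq_none {n : ℕ} {M : Type} (G : SimpleGraph (Fin n)) {ident : Fin n → ℕ}
    (msg : Fin n → ℕ → M) {v : Fin n} {j : ℕ} (h : ∀ u, G.Adj v u → ident u ≠ j) :
    inbox G ident msg v j = none :=
  dif_neg fun ⟨u, hu, huj⟩ => h u hu huj

/-- In `t` rounds an algorithm cannot distinguish a node from its image under a symmetry of the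
input if the identifiers agree in the radius-`t` neighbourhoods. -/
lemma LocalAlgorithm.stateAfter_eq_of_agree (A : LocalAlgorithm) {n : ℕ} (I : Input n)
    {ident ident' : Fin n → ℕ} (hid : Function.Injective ident)
    (hid' : Function.Injective ident') (φ : Equiv.Perm (Fin n))
    (hφ : ∀ u v, I.G.Adj (φ u) (φ v) ↔ I.G.Adj u v)
    (hα : ∀ v, φ v ∈ I.α ↔ v ∈ I.α) (hβ : ∀ v, φ v ∈ I.β ↔ v ∈ I.β)
    (R : ℕ → Fin n → Prop) (hR : ∀ t v, R (t + 1) v → R t v)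
    (hRadj : ∀ t v u, R (t + 1) v → I.G.Adj v u → R t u)
    (hag : ∀ t v, R t v → ident' (φ v) = ident v) (t : ℕ) :
    ∀ v, R t v → A.stateAfter I ident t v = A.stateAfter I ident' t (φ v) := by
  induction t with
  | zero =>
    intro v hv
    simp only [stateAfter, hag 0 v hv]
    rw [decide_eq_decide.mpr (hα v), decide_eq_decide.mpr (hβ v)]
  | succ t ih =>
    intro v hv
    simp only [stateAfter]
    rw [ih v (hR t v hv)]
    congr 1
    funext j
    by_cases h : ∃ u, I.G.Adj v u ∧ ident u = j
    · obtain ⟨u, hu, rfl⟩ := h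
      rw [inbox_eq_some _ hid _ hu, ← hag t u (hRadj t v u hv hu),
        inbox_eq_some _ hid' _ ((hφ v u).mpr hu), hag _ v hv, ih u (hRadj t v u hv hu)]
    · push Not at h
      rw [inbox_eq_none _ _ h, inbox_eq_none]
      intro w hw
      obtain ⟨u, rfl⟩ := φ.surjective w
      have hu := (hφ v u).mp hw
      rw [hag t u (hRadj t v u hv hu)]
      exact h u hu

/-! ### Views and locally computable quantities -/

/-- Everything that a node can learn in a number of rounds. -/
inductive View : Type
  | init (n ident : ℕ) (inα inβ : Bool) : View
  | step (v : View) (inbox : ℕ → Option View) : View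

/-- The number of nodes, as recorded in a view. -/
def View.size : View → ℕ
  | .init n _ _ _ => n
  | .step v _ => v.size

/-- The identifier of a node, as recorded in its view. -/
def View.ident : View → ℕ
  | .init _ j _ _ => j
  | .step v _ => v.ident

/-- Membership of a node in `α`, as recorded in its view. -/
def View.inα : View → Bool
  | .init _ _ a _ => a
  | .step v _ => v.inα

/-- Membership of a node in `β`, as recorded in its view. -/
def View.inβ : View → Bool
  | .init _ _ _ b => b
  | .step v _ => v.inβ

/-- The view of the preceding round. -/
def View.prev : View → View
  | .init n j a b => .init n j a b
  | .step v _ => v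

/-- The views received from the neighbours in the last round. -/
def View.received : View → Set View
  | .init _ _ _ _ => ∅
  | .step _ inb => {w | ∃ j, inb j = some w}

/-- The algorithm in which all nodes keep sending everything they know. -/
def fullInfo (out : View → List Bool) : LocalAlgorithm where
  State := View
  Msg := View
  init := View.init
  send s _ := s
  receive := View.step
  output := out

/-- The view of a node after `t` rounds. -/
noncomputable def view {n : ℕ} (I : Input n) (ident : Fin n → ℕ) (t : ℕ) (v : Fin n) : View :=
  (fullInfo fun _ => []).stateAfter I ident t v

lemma fullInfo_stateAfter (out : View → List Bool) {n : ℕ} (I : Input n) (ident : Fin n → ℕ)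
    (t : ℕ) (v : Fin n) : (fullInfo out).stateAfter I ident t v = view I ident t v := by
  induction t generalizing v with
  | zero => rfl
  | succ t ih =>
    have h : (fullInfo out).stateAfter I ident t = view I ident t := funext ih
    show View.step _ (inbox I.G ident (fun u _ => (fullInfo out).stateAfter I ident t u) v) =
      View.step _ (inbox I.G ident (fun u _ => view I ident t u) v)
    rw [h]
    rfl

lemma view_succ {n : ℕ} (I : Input n) (ident : Fin n → ℕ) (t : ℕ) (v : Fin n) :
    view I ident (t + 1) v =
      .step (view I ident t v) (inbox I.G ident (fun u _ => view I ident t u) v) := rfl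

lemma view_size {n : ℕ} (I : Input n) (ident : Fin n → ℕ) (t : ℕ) (v : Fin n) :
    (view I ident t v).size = n := by
  induction t with
  | zero => rfl
  | succ t ih => rw [view_succ]; exact ih

lemma view_ident {n : ℕ} (I : Input n) (ident : Fin n → ℕ) (t : ℕ) (v : Fin n) :
    (view I ident t v).ident = ident v := by
  induction t with
  | zero => rfl
  | succ t ih => rw [view_succ]; exact ih

lemma view_inα {n : ℕ} (I : Input n) (ident : Fin n → ℕ) (t : ℕ) (v : Fin n) :
    (view I ident t v).inα = true ↔ v ∈ I.α := by
  induction t with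
  | zero => exact @decide_eq_true_iff _ (Classical.propDecidable _)
  | succ t ih => rw [view_succ]; exact ih

lemma view_inβ {n : ℕ} (I : Input n) (ident : Fin n → ℕ) (t : ℕ) (v : Fin n) :
    (view I ident t v).inβ = true ↔ v ∈ I.β := by
  induction t with
  | zero => exact @decide_eq_true_iff _ (Classical.propDecidable _)
  | succ t ih => rw [view_succ]; exact ih

lemma view_succ_received {n : ℕ} (I : Input n) {ident : Fin n → ℕ}
    (hid : Function.Injective ident) (t : ℕ) (v : Fin n) :
    (view I ident (t + 1) v).received = {w | ∃ u, I.G.Adj v u ∧ view I ident t u = w} := by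
  rw [view_succ]
  ext w
  constructor
  · rintro ⟨j, hj⟩
    by_cases h : ∃ u, I.G.Adj v u ∧ ident u = j
    · obtain ⟨u, hu, rfl⟩ := h
      rw [inbox_eq_some _ hid _ hu] at hj
      exact ⟨u, hu, Option.some.inj hj⟩
    · push Not at h
      rw [inbox_eq_none _ _ h] at hj
      cases hj
  · rintro ⟨u, hu, rfl⟩
    exact ⟨ident u, inbox_eq_some _ hid _ hu⟩

/-- A quantity attached to the nodes of `n`-node inputs with identifiers. -/
abbrev NodeFun (n : ℕ) (X : Type) := Input n → (Fin n → ℕ) → Fin n → X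

/-- The quantity `f` can be computed by all nodes in `T` rounds. -/
def IsLocal {n : ℕ} {X : Type} (T : ℕ) (f : NodeFun n X) : Prop :=
  ∃ F : View → X, ∀ I ident, Function.Injective ident → ∀ v, f I ident v = F (view I ident T v)

namespace IsLocal

variable {n T T' : ℕ} {X Y Z : Type}

lemma comp (g : X → Y) {f : NodeFun n X} (hf : IsLocal T f) :
    IsLocal T (fun I ident v => g (f I ident v)) := by
  obtain ⟨F, hF⟩ := hf
  exact ⟨fun w => g (F w), fun I ident hid v => congrArg g (hF I ident hid v)⟩

lemma comp₂ (g : X → Y → Z) {f : NodeFun n X} {f' : NodeFun n Y} (hf : IsLocal T f)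
    (hf' : IsLocal T f') : IsLocal T (fun I ident v => g (f I ident v) (f' I ident v)) := by
  obtain ⟨F, hF⟩ := hf
  obtain ⟨F', hF'⟩ := hf'
  exact ⟨fun w => g (F w) (F' w), fun I ident hid v => 
    congrArg₂ g (hF I ident hid v) (hF' I ident hid v)⟩

lemma succ {f : NodeFun n X} (hf : IsLocal T f) : IsLocal (T + 1) f := by
  obtain ⟨F, hF⟩ := hf
  exact ⟨fun w => F w.prev, fun I ident hid v => hF I ident hid v⟩

lemma mono {f : NodeFun n X} (hf : IsLocal T f) (h : T ≤ T') : IsLocal T' f := by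
  induction h with
  | refl => exact hf
  | step _ ih => exact ih.succ

lemma mem_α : IsLocal T (fun (I : Input n) _ v => v ∈ I.α) :=
  ⟨fun w => w.inα = true, fun I ident _ v => propext (view_inα I ident T v).symm⟩

lemma mem_β : IsLocal T (fun (I : Input n) _ v => v ∈ I.β) :=
  ⟨fun w => w.inβ = true, fun I ident _ v => propext (view_inβ I ident T v).symm⟩

lemma ident : IsLocal T (fun (_ : Input n) ident v => ident v) :=
  ⟨View.ident, fun I ident _ v => (view_ident I ident T v).symm⟩

lemma const (x : X) : IsLocal T (fun (_ : Input n) _ _ => x) := ⟨fun _ => x, fun _ _ _ _ => rfl⟩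

lemma iUnion_adj {f : NodeFun n (Set X)} (hf : IsLocal T f) :
    IsLocal (T + 1) (fun I ident v => {x | ∃ u, I.G.Adj v u ∧ x ∈ f I ident u}) := by
  obtain ⟨F, hF⟩ := hf
  refine ⟨fun w => {x | ∃ w' ∈ w.received, x ∈ F w'}, fun I ident hid v => ?_⟩
  ext x
  simp only [view_succ_received I hid, Set.mem_ofPred_eq]
  constructor
  · rintro ⟨u, hu, hx⟩
    exact ⟨_, ⟨u, hu, rfl⟩, by rwa [← hF I ident hid]⟩
  · rintro ⟨_, ⟨u, hu, rfl⟩, hx⟩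
    exact ⟨u, hu, by rwa [hF I ident hid]⟩

lemma exists_adj {f : NodeFun n Prop} (hf : IsLocal T f) :
    IsLocal (T + 1) (fun I ident v => ∃ u, I.G.Adj v u ∧ f I ident u) :=
  (hf.comp fun p => {_x : Unit | p}).iUnion_adj.comp (fun s => () ∈ s)

end IsLocal

/-! ### Walks of length four and colour reduction -/

/-- There is a walk of length four from `v` to `u`. -/
def Walk4 {V : Type*} (G : SimpleGraph V) (v u : V) : Prop :=
  ∃ x, G.Adj v x ∧ ∃ y, G.Adj x y ∧ ∃ z, G.Adj y z ∧ G.Adj z u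

lemma Walk4.symm {V : Type*} {G : SimpleGraph V} {v u : V} (h : Walk4 G v u) : Walk4 G u v := by
  obtain ⟨x, h1, y, h2, z, h3, h4⟩ := h
  exact ⟨z, h4.symm, y, h3.symm, x, h2.symm, h1.symm⟩

lemma Walk4.of_adj_adj {V : Type*} {G : SimpleGraph V} {v x u : V} (h : G.Adj v x)
    (h' : G.Adj x u) : Walk4 G v u :=
  ⟨x, h, v, h.symm, x, h, h'⟩

lemma IsLocal.image_walk4 {n T : ℕ} {X : Type} {f : NodeFun n X} (hf : IsLocal T f) :
    IsLocal (T + 4) (fun I ident v => {x | ∃ u, Walk4 I.G v u ∧ f I ident u = x}) := by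
  have h := (hf.comp fun x => ({x} : Set X)).iUnion_adj.iUnion_adj.iUnion_adj.iUnion_adj
  convert h using 5 with I ident v
  funext x
  refine propext ⟨?_, ?_⟩
  · rintro ⟨u, ⟨a, h1, b, h2, c, h3, h4⟩, rfl⟩
    exact ⟨a, h1, b, h2, c, h3, u, h4, rfl⟩
  · rintro ⟨a, h1, b, h2, c, h3, u, h4, h5⟩
    exact ⟨u, ⟨a, h1, b, h2, c, h3, h4⟩, h5.symm⟩

/-- A colour reduction step: colours with `L` bits are replaced by colours with
`card ι * (log L + 2)` bits. The new colour consists of a list of positions that distinguish the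
old colour from those in a set that is listed by `ι`, and of the bits at these positions. -/
lemma exists_colorReduction (ι : Type) [Fintype ι] {L : ℕ} (hL : 1 ≤ L) :
    ∃ red : ℕ → Set ℕ → ℕ,
      (∀ c S, red c S < 2 ^ (Fintype.card ι * (Nat.log 2 L + 2))) ∧
      ∀ c S c' S', c < 2 ^ L → c' < 2 ^ L → (∀ x ∈ S, x < 2 ^ L) → (∀ x ∈ S', x < 2 ^ L) →
        (∃ e : ι → ℕ, S ⊆ Set.range e) → (∃ e : ι → ℕ, S' ⊆ Set.range e) →
        c ∉ S → c' ∉ S' → c' ∈ S → red c S ≠ red c' S' := by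
  classical
  have hcard : Fintype.card (ι → Fin L × Bool) ≤
      Fintype.card (Fin (2 ^ (Fintype.card ι * (Nat.log 2 L + 2)))) := by
    have h := Nat.lt_pow_succ_log_self (b := 2) (by norm_num) L
    simp only [Fintype.card_fun, Fintype.card_prod, Fintype.card_fin, Fintype.card_bool]
    calc (L * 2) ^ Fintype.card ι ≤ (2 ^ (Nat.log 2 L + 2)) ^ Fintype.card ι := by
          gcongr
          rw [pow_succ]
          exact Nat.mul_le_mul_right _ h.le
      _ = 2 ^ (Fintype.card ι * (Nat.log 2 L + 2)) := by rw [← pow_mul, mul_comm]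
  obtain ⟨emb⟩ := Function.Embedding.nonempty_of_card_le hcard
  let P : ℕ → Set ℕ → (ι → Fin L) → Prop := fun c S g =>
    ∀ x ∈ S, ∃ t, x.testBit (g t) ≠ c.testBit (g t)
  have hP : ∀ c S, c < 2 ^ L → (∀ x ∈ S, x < 2 ^ L) → (∃ e : ι → ℕ, S ⊆ Set.range e) → c ∉ S →
      ∃ g, P c S g := by
    rintro c S hc hS ⟨e, he⟩ hcS
    have hbit : ∀ t, ∃ i : Fin L, e t ∈ S → (e t).testBit i ≠ c.testBit i := by
      intro t
      by_cases ht : e t ∈ S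
      · obtain ⟨i, hi⟩ : ∃ i, (e t).testBit i ≠ c.testBit i := by
          by_contra! h
          exact hcS (Nat.eq_of_testBit_eq h ▸ ht)
        have hiL : i < L := by
          by_contra! h
          have hpow := Nat.pow_le_pow_right (n := 2) (by norm_num) h
          rw [Nat.testBit_lt_two_pow ((hS _ ht).trans_le hpow),
            Nat.testBit_lt_two_pow (hc.trans_le hpow)] at hi
          exact hi rfl
        exact ⟨⟨i, hiL⟩, fun _ => hi⟩
      · exact ⟨⟨0, hL⟩, fun h => absurd h ht⟩
    choose g hg using hbit
    refine ⟨g, fun x hx => ?_⟩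
    obtain ⟨t, rfl⟩ := he hx
    exact ⟨t, hg t hx⟩
  refine ⟨fun c S => if h : ∃ g, P c S g then
    (emb fun t => (h.choose t, c.testBit (h.choose t))).val else 0, ?_, ?_⟩
  · intro c S
    dsimp only
    split_ifs with h
    · exact (emb _).isLt
    · positivity
  · intro c S c' S' hc hc' hS hS' he he' hcS hcS' hmem heq
    have h := hP c S hc hS he hcS
    have h' := hP c' S' hc' hS' he' hcS'
    dsimp only at heq
    rw [dif_pos h, dif_pos h'] at heq
    have heq' := emb.injective (Fin.val_injective heq)
    -- The positions chosen for `c` contain one where `c'` has a different bit, but equal new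
    -- colours mean equal positions and equal bits there.
    obtain ⟨t, ht⟩ := h.choose_spec c' hmem
    have h1 := congrFun heq' t
    simp only [Prod.mk.injEq] at h1
    rw [h1.2, h1.1] at ht
    exact ht rfl

/-! ### The ring inputs -/

/-- The nodes of the ring graph: `m` blocks, each with two sides of `r + 1` nodes. -/
abbrev Vtx (m r : ℕ) : Type := ZMod m × Bool × Fin (r + 1)

/-- The neighbours of a node in the ring graph: all nodes of the other side of the same block, and
one node of the next or the previous block. -/
def ringNbr {m r : ℕ} (p : Vtx m r) : Option (Fin (r + 1)) → Vtx m r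
  | none => (if p.2.1 then p.1 + 1 else p.1 - 1, !p.2.1, p.2.2)
  | some j => (p.1, !p.2.1, j)

/-- The ring graph: in each block the two sides form a complete bipartite graph, and the second side
of each block is joined to the first side of the next block by a perfect matching. -/
def ringGraph (m r : ℕ) : SimpleGraph (Vtx m r) where
  Adj p q := ∃ o, ringNbr p o = q
  symm := ⟨by
    rintro ⟨i, s, j⟩ q ⟨o, rfl⟩
    cases o with
    | none => exact ⟨none, by cases s <;> simp [ringNbr]⟩
    | some j' => exact ⟨some j, by cases s <;> simp [ringNbr]⟩⟩
  loopless := ⟨by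
    rintro ⟨i, s, j⟩ ⟨o, h⟩
    cases o <;> cases s <;> simp [ringNbr] at h⟩

variable {m r : ℕ}

lemma ringGraph_adj_side {p q : Vtx m r} (h : (ringGraph m r).Adj p q) : q.2.1 = !p.2.1 := by
  obtain ⟨o, rfl⟩ := h
  cases o <;> rfl

lemma ringGraph_adj_same_block (i : ZMod m) (s : Bool) (j j' : Fin (r + 1)) :
    (ringGraph m r).Adj (i, s, j) (i, !s, j') := ⟨some j', rfl⟩

lemma ringGraph_adj_next_block (i : ZMod m) (j : Fin (r + 1)) :
    (ringGraph m r).Adj (i, true, j) (i + 1, false, j) := ⟨none, rfl⟩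

lemma ringNbr_injective (hm : 3 ≤ m) (p : Vtx m r) : Function.Injective (ringNbr p) := by
  have : Fact (1 < m) := ⟨by omega⟩
  obtain ⟨i, s, j⟩ := p
  intro o o' h
  cases o <;> cases o' <;> cases s <;> simp_all [ringNbr, eq_sub_iff_add_eq]

lemma ringGraph_card_neighborSet (hm : 3 ≤ m) (p : Vtx m r) :
    Nat.card ((ringGraph m r).neighborSet p) = r + 2 := by
  have h : (ringGraph m r).neighborSet p = Set.range (ringNbr p) := rfl
  rw [h, Nat.card_range_of_injective (ringNbr_injective hm p)]
  simp

lemma ringGraph_connected (hm : 3 ≤ m) : (ringGraph m r).Connected := by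
  have : NeZero m := ⟨by omega⟩
  have hblock : ∀ (i : ZMod m) (s s' : Bool) (j j' : Fin (r + 1)),
      (ringGraph m r).Reachable (i, s, j) (i, s', j') := by
    intro i s s' j j'
    have h1 := (ringGraph_adj_same_block i s j j').reachable
    have h2 := (ringGraph_adj_same_block i (!s) j' j').reachable
    cases s <;> cases s' <;> first | exact h1 | exact h1.trans h2
  have hnat : ∀ i : ℕ, (ringGraph m r).Reachable (0, false, 0) ((i : ZMod m), false, 0) := by
    intro i
    induction i with
    | zero => simp
    | succ i ih =>
      push_cast
      exact (ih.trans (hblock _ _ true 0 0)).trans (ringGraph_adj_next_block _ _).reachable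
  have hzero : ∀ p : Vtx m r, (ringGraph m r).Reachable (0, false, 0) p := by
    rintro ⟨i, s, j⟩
    have h := hnat i.val
    rw [ZMod.natCast_zmod_val] at h
    exact h.trans (hblock _ _ _ _ _)
  exact { preconnected := fun p q => (hzero p).symm.trans (hzero q), nonempty := ⟨(0, false, 0)⟩ }

/-- The input `I` is a ring graph, where `α` and `β` are its two sides. -/
structure IsRing {n : ℕ} (I : Input n) (e : Fin n ≃ Vtx m r) : Prop where
  adj : ∀ u v, I.G.Adj u v ↔ (ringGraph m r).Adj (e u) (e v)
  mem_α : ∀ v, v ∈ I.α ↔ (e v).2.1 = false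
  mem_β : ∀ v, v ∈ I.β ↔ (e v).2.1 = true

/-- The `n`-node ring inputs of degree `r + 2`. -/
def ringInputs (r n : ℕ) : Set (Input n) :=
  {I | ∃ m, 3 ≤ m ∧ ∃ e : Fin n ≃ Vtx m r, IsRing I e}

lemma isMIS_side {n : ℕ} (s : Bool) (e : Fin n ≃ Vtx m r) :
    IsMIS ((ringGraph m r).comap e) {v | (e v).2.1 = s} := by
  refine ⟨?_, ?_⟩
  · intro u hu v hv _ hadj
    have h := ringGraph_adj_side hadj
    simp only [Set.mem_ofPred_eq] at hu hv
    rw [hu, hv] at h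
    cases s <;> simp at h
  · intro U hU hle v hv
    by_contra hs
    have hs' : (e v).2.1 = !s := Bool.eq_not.mpr hs
    rcases hp : e v with ⟨i, s', j⟩
    rw [hp] at hs'
    simp only at hs'
    have hadj : (ringGraph m r).Adj (e v) (e (e.symm (i, !s', j))) := by
      rw [e.apply_symm_apply, hp]
      exact ringGraph_adj_same_block _ _ _ _
    have hmem : e.symm (i, !s', j) ∈ U := hle (by simp [hs'])
    exact hU hv hmem (fun h => hadj.ne (congrArg e h)) hadj

lemma exists_isRing {n : ℕ} (e : Fin n ≃ Vtx m r) : ∃ I : Input n, IsRing I e :=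
  ⟨⟨(ringGraph m r).comap e, {v | (e v).2.1 = false}, {v | (e v).2.1 = true},
    isMIS_side _ e, isMIS_side _ e⟩, fun _ _ => Iff.rfl, fun _ => Iff.rfl, fun _ => Iff.rfl⟩

lemma card_vtx [NeZero m] : Fintype.card (Vtx m r) = 2 * (r + 1) * m := by
  simp only [Vtx, Fintype.card_prod, ZMod.card, Fintype.card_bool, Fintype.card_fin]
  ring

lemma eq_of_equiv_vtx {n : ℕ} (hm : 3 ≤ m) (e : Fin n ≃ Vtx m r) : n = 2 * (r + 1) * m := by
  have : NeZero m := ⟨by omega⟩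
  rw [← card_vtx, ← Fintype.card_congr e, Fintype.card_fin]

lemma ringInputs_nonempty (hm : 3 ≤ m) : (ringInputs r (2 * (r + 1) * m)).Nonempty := by
  have : NeZero m := ⟨by omega⟩
  have e : Fin (2 * (r + 1) * m) ≃ Vtx m r := (Fintype.equivFinOfCardEq card_vtx).symm
  obtain ⟨I, hI⟩ := exists_isRing e
  exact ⟨I, m, hm, e, hI⟩

lemma infinite_ringInputs_nonempty (r : ℕ) : {n | (ringInputs r n).Nonempty}.Infinite := by
  refine Set.infinite_of_injective_forall_mem (f := fun m => 2 * (r + 1) * (m + 3)) ?_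
    fun m => ringInputs_nonempty (by omega)
  intro m m' h
  have h' := Nat.eq_of_mul_eq_mul_left (by omega) h
  omega

lemma isConnectedRegular_of_mem_ringInputs {n : ℕ} {I : Input n} (hI : I ∈ ringInputs r n) :
    I.IsConnectedRegular (r + 2) := by
  obtain ⟨m, hm, e, he⟩ := hI
  have iso : I.G ≃g ringGraph m r := ⟨e, fun {a b} => (he.adj a b).symm⟩
  refine ⟨iso.connected_iff.mpr (ringGraph_connected hm), fun v => ?_⟩
  have h := (Nat.card_congr (iso.mapNeighborSet v)).trans (ringGraph_card_neighborSet hm _)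
  classical
  rw [Nat.card_eq_fintype_card, SimpleGraph.card_neighborSet_eq_degree] at h
  convert h

/-- The properties of ring inputs that are used to compute reconfiguration schedules. -/
structure Input.IsTwinFreeBipartite {n : ℕ} (I : Input n) (ι : Type) : Prop where
  mem_β_iff : ∀ v, v ∈ I.β ↔ v ∉ I.α
  adj_side : ∀ u v, I.G.Adj u v → (u ∈ I.α ↔ v ∉ I.α)
  adj_range : ∀ v, ∃ e : ι → Fin n, ∀ u, I.G.Adj v u → u ∈ Set.range e
  exists_adj : ∀ v, ∃ u, I.G.Adj v u
  exists_two_adj : ∀ v, ∃ u u', u ≠ u' ∧ I.G.Adj v u ∧ I.G.Adj v u'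
  twinFree : ∀ u ∈ I.β, ∀ v ∈ I.β, u ≠ v → ∃ w, I.G.Adj u w ∧ ¬I.G.Adj v w

lemma isTwinFreeBipartite_of_mem_ringInputs {n : ℕ} {I : Input n} (hI : I ∈ ringInputs r n) :
    I.IsTwinFreeBipartite (Option (Fin (r + 1))) := by
  obtain ⟨m, hm, e, he⟩ := hI
  have : Fact (1 < m) := ⟨by omega⟩
  have hnbr : ∀ v o, I.G.Adj v (e.symm (ringNbr (e v) o)) := fun v o => by
    rw [he.adj, e.apply_symm_apply]
    exact ⟨o, rfl⟩
  have hinj : ∀ v, Function.Injective fun o => e.symm (ringNbr (e v) o) := fun v =>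
    e.symm.injective.comp (ringNbr_injective hm _)
  refine ⟨?_, ?_, ?_, ?_, ?_, ?_⟩
  · intro v
    rw [he.mem_β, he.mem_α, Bool.not_eq_false]
  · intro u v h
    rw [he.mem_α, he.mem_α, ringGraph_adj_side ((he.adj u v).mp h)]
    cases (e u).2.1 <;> simp
  · refine fun v => ⟨fun o => e.symm (ringNbr (e v) o), fun u hu => ?_⟩
    obtain ⟨o, ho⟩ := (he.adj v u).mp hu
    exact ⟨o, by simp [ho]⟩
  · exact fun v => ⟨_, hnbr v none⟩
  · exact fun v => ⟨_, _, (hinj v).ne (Option.some_ne_none 0).symm, hnbr v none, hnbr v (some 0)⟩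
  · intro u hu v hv huv
    by_contra! hall
    have h0 := fun o => (he.adj _ _).mp (hall _ (hnbr u o))
    simp only [e.apply_symm_apply] at h0
    have hne : e u ≠ e v := e.injective.ne huv
    rw [he.mem_β] at hu hv
    rcases hp : e u with ⟨i, s, j⟩
    rcases hq : e v with ⟨i', s', j'⟩
    rw [hp] at hu h0
    rw [hq] at hv h0
    rw [hp, hq] at hne
    simp only at hu hv
    subst hu hv
    obtain ⟨o, ho⟩ := h0 none
    obtain ⟨o', ho'⟩ := h0 (some j)
    -- Distinct twins would have to lie in blocks that both follow and precede each other. This is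
    -- where `m = 2` must be excluded.
    have h2 : (2 : ZMod m) ≠ 0 := by
      have h := (ZMod.natCast_eq_zero_iff 2 m).not.mpr fun h => by
        have := Nat.le_of_dvd (by norm_num) h
        omega
      exact_mod_cast h
    cases o with
    | none =>
      simp only [ringNbr, if_true, Prod.mk.injEq, add_left_inj] at ho
      exact hne (by simp [ho.1, ho.2.2])
    | some t =>
      cases o' with
      | none =>
        simp only [ringNbr, if_true, Prod.mk.injEq] at ho ho'
        refine h2 ?_
        have h := ho.1
        rw [← ho'.1] at h
        linear_combination -h
      | some t' =>
        simp only [ringNbr, if_true, Prod.mk.injEq] at ho ho'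
        have h := ho.1
        rw [← ho'.1] at h
        simp at h

/-! ### Distributed colouring and greedy selection -/

/-- In `4 * i` rounds one can find a colouring with `numBits Δ a n i` bits in which nodes that are
joined by a walk of length four have different colours. -/
lemma exists_walk4_coloring (ι : Type) [Fintype ι] [Nonempty ι] {a : ℕ} (ha : 1 ≤ a) (n i : ℕ) :
    ∃ c : NodeFun n ℕ, IsLocal (4 * i) c ∧
      ∀ I : Input n, I.IsTwinFreeBipartite ι → ∀ ident, IsIdentAssignment n a ident →
        (∀ v, c I ident v < 2 ^ numBits (Fintype.card (ι × ι × ι × ι)) a n i) ∧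
        ∀ v u, Walk4 I.G v u → u ≠ v → c I ident v ≠ c I ident u := by
  induction i with
  | zero =>
    refine ⟨fun _ ident v => ident v, IsLocal.ident, fun I _ ident hid => ⟨fun v => ?_,
      fun v u _ huv h => huv (hid.1 h).symm⟩⟩
    calc ident v ≤ n ^ a := (hid.2 v).2
      _ < (2 ^ (Nat.log 2 n + 1)) ^ a :=
        Nat.pow_lt_pow_left (Nat.lt_pow_succ_log_self (by norm_num) n) (by omega)
      _ = 2 ^ (a * (Nat.log 2 n + 1)) := by rw [← pow_mul, mul_comm]
  | succ i ih =>
    obtain ⟨c, hloc, hc⟩ := ih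
    obtain ⟨red, hlt, hred⟩ := exists_colorReduction (ι × ι × ι × ι)
      (numBits_pos (Fintype.card_pos (α := ι × ι × ι × ι)) ha n i)
    -- The own colour is removed because closed walks of length four make it appear in the list.
    refine ⟨fun I ident v =>
      red (c I ident v) ({x | ∃ u, Walk4 I.G v u ∧ c I ident u = x} \ {c I ident v}), ?_, ?_⟩
    · exact (hloc.mono (by omega)).comp₂ (fun x S => red x (S \ {x})) hloc.image_walk4
    · intro I hI ident hid
      obtain ⟨hb, hne⟩ := hc I hI ident hid
      refine ⟨fun v => hlt _ _, fun v u hvu huv => ?_⟩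
      have hbound : ∀ v, ∀ x ∈ {x | ∃ u, Walk4 I.G v u ∧ c I ident u = x} \ {c I ident v},
          x < 2 ^ numBits (Fintype.card (ι × ι × ι × ι)) a n i := by
        rintro v _ ⟨⟨u, -, rfl⟩, -⟩
        exact hb u
      have hrange : ∀ v, ∃ f : ι × ι × ι × ι → ℕ,
          {x | ∃ u, Walk4 I.G v u ∧ c I ident u = x} \ {c I ident v} ⊆ Set.range f := by
        intro v
        choose g hg using hI.adj_range
        refine ⟨fun t => c I ident (g (g (g (g v t.1) t.2.1) t.2.2.1) t.2.2.2), ?_⟩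
        rintro _ ⟨⟨u, ⟨x, h1, y, h2, z, h3, h4⟩, rfl⟩, -⟩
        obtain ⟨t1, rfl⟩ := hg _ _ h1
        obtain ⟨t2, rfl⟩ := hg _ _ h2
        obtain ⟨t3, rfl⟩ := hg _ _ h3
        obtain ⟨t4, rfl⟩ := hg _ _ h4
        exact ⟨(t1, t2, t3, t4), rfl⟩
      exact hred _ _ _ _ (hb v) (hb u) (hbound v) (hbound u) (hrange v) (hrange u)
        (fun h => h.2 rfl) (fun h => h.2 rfl) ⟨⟨u, hvu, rfl⟩, (hne v u hvu huv).symm⟩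

/-- The greedy choice, colour by colour, of nodes in `β` that are not joined by walks of length
four to nodes chosen before. -/
def greedy {n : ℕ} (c : NodeFun n ℕ) : ℕ → NodeFun n Prop
  | 0 => fun _ _ _ => False
  | t + 1 => fun I ident v => greedy c t I ident v ∨
      (v ∈ I.β ∧ c I ident v = t) ∧ ¬∃ u, Walk4 I.G v u ∧ greedy c t I ident u

section greedy

variable {n T : ℕ} {c : NodeFun n ℕ}

lemma isLocal_greedy (hc : IsLocal T c) (t : ℕ) : IsLocal (T + 4 * t) (greedy c t) := by
  induction t with
  | zero => exact IsLocal.const False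
  | succ t ih =>
    have h : IsLocal (T + 4 * (t + 1))
        (fun I ident v => ∃ u, Walk4 I.G v u ∧ greedy c t I ident u) := by
      have h' := ih.image_walk4.comp (fun S => True ∈ S)
      simp only [Set.mem_ofPred_eq, eq_iff_iff, iff_true] at h'
      exact h'
    have h1 := IsLocal.mem_β.comp₂ And ((hc.comp (· = t)).mono (Nat.le_add_right T (4 * (t + 1))))
    exact (ih.mono (by omega)).comp₂ Or (h1.comp₂ (fun p q => p ∧ ¬q) h)

variable {I : Input n} {ident : Fin n → ℕ}

lemma greedy_mono {s t : ℕ} (hst : s ≤ t) {v : Fin n} (h : greedy c s I ident v) :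
    greedy c t I ident v := by
  induction hst with
  | refl => exact h
  | step _ ih => exact Or.inl ih

lemma greedy_mem_β {t : ℕ} {v : Fin n} (h : greedy c t I ident v) : v ∈ I.β := by
  induction t with
  | zero => exact h.elim
  | succ t ih => exact h.elim ih fun h => h.1.1

lemma greedy_isolated (hc : ∀ v u, Walk4 I.G v u → u ≠ v → c I ident v ≠ c I ident u) (t : ℕ) :
    ∀ v u, greedy c t I ident v → greedy c t I ident u → Walk4 I.G v u → u = v := by
  induction t with
  | zero => exact fun v u h => h.elim
  | succ t ih =>
    rintro v u (hv | hv) (hu | hu) hvu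
    · exact ih v u hv hu hvu
    · exact absurd ⟨v, hvu.symm, hv⟩ hu.2
    · exact absurd ⟨u, hvu, hu⟩ hv.2
    · by_contra hne
      exact hc v u hvu hne (hv.1.2.trans hu.1.2.symm)

/-- When its colour has its turn, `v` is either blocked by a node chosen before or chosen itself. -/
lemma exists_greedy {K : ℕ} (hself : ∀ v, Walk4 I.G v v) {v : Fin n} (hv : v ∈ I.β)
    (hK : c I ident v < K) : ∃ u, Walk4 I.G v u ∧ greedy c K I ident u := by
  by_cases h : ∃ u, Walk4 I.G v u ∧ greedy c (c I ident v) I ident u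
  · obtain ⟨u, hu, hgu⟩ := h
    exact ⟨u, hu, greedy_mono hK.le hgu⟩
  · exact ⟨v, hself v, greedy_mono (s := c I ident v + 1) hK (Or.inr ⟨⟨hv, rfl⟩, h⟩)⟩

end greedy

/-! ### The reconfiguration schedule -/

section schedule

variable {V : Type*} {G : SimpleGraph V}

/-- The set of all neighbours of nodes in `U`. -/
def nbrs (G : SimpleGraph V) (U : Set V) : Set V := {v | ∃ u, G.Adj v u ∧ u ∈ U}

/-- There is a node of `U` at distance at most `j` from `v`. -/
def IsNear (G : SimpleGraph V) (U : Set V) (j : ℕ) (v : V) : Prop := ∃ u ∈ U, G.edist v u ≤ (j : ℕ∞)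

lemma isNear_of_mem {U : Set V} {v : V} (h : v ∈ U) : IsNear G U 0 v := ⟨v, h, by simp⟩

lemma IsNear.of_adj {U : Set V} {j : ℕ} {v u : V} (hu : IsNear G U j u) (h : G.Adj v u) :
    IsNear G U (j + 1) v := by
  obtain ⟨w, hw, hj⟩ := hu
  refine ⟨w, hw, ?_⟩
  have h1 : G.edist v u ≤ 1 := SimpleGraph.edist_le_one_iff_adj_or_eq.mpr (Or.inl h)
  calc G.edist v w ≤ G.edist v u + G.edist u w := SimpleGraph.edist_triangle ..
    _ ≤ 1 + (j : ℕ∞) := add_le_add h1 hj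
    _ = ((j + 1 : ℕ) : ℕ∞) := by push_cast; exact add_comm _ _

lemma IsNear.mono {U U' : Set V} {j j' : ℕ} {v : V} (h : IsNear G U j v) (hU : U ⊆ U')
    (hj : j ≤ j') : IsNear G U' j' v := by
  obtain ⟨w, hw, hd⟩ := h
  exact ⟨w, hU hw, hd.trans (by exact_mod_cast hj)⟩

lemma isNear_of_walk4 {U : Set V} {v u : V} (h : Walk4 G v u) (hu : u ∈ U) : IsNear G U 4 v := by
  obtain ⟨x, h1, y, h2, z, h3, h4⟩ := h
  exact ((((isNear_of_mem hu).of_adj h4).of_adj h3).of_adj h2).of_adj h1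

/-- The reconfiguration schedule in which the regions that have switched from `α` to `β` grow
around the nodes of `X`. -/
def growSchedule (G : SimpleGraph V) (α β X : Set V) : List (Set V) :=
  [α, α \ nbrs G X, X ∪ α \ nbrs G X, X ∪ α \ nbrs G (nbrs G (nbrs G X)),
    nbrs G (nbrs G X) ∪ α \ nbrs G (nbrs G (nbrs G X)), nbrs G (nbrs G X), β]

variable {n : ℕ} {I : Input n} {ι : Type}

lemma Input.IsTwinFreeBipartite.walk4_self (hI : I.IsTwinFreeBipartite ι) (v : Fin n) :
    Walk4 I.G v v := by
  obtain ⟨u, hu⟩ := hI.exists_adj v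
  exact Walk4.of_adj_adj hu hu.symm

lemma Input.IsTwinFreeBipartite.nbrs_subset_α (hI : I.IsTwinFreeBipartite ι) {U : Set (Fin n)}
    (hU : U ⊆ I.β) : nbrs I.G U ⊆ I.α := by
  rintro v ⟨u, hvu, hu⟩
  exact (hI.adj_side v u hvu).mpr ((hI.mem_β_iff u).mp (hU hu))

lemma Input.IsTwinFreeBipartite.nbrs_subset_β (hI : I.IsTwinFreeBipartite ι) {U : Set (Fin n)}
    (hU : U ⊆ I.α) : nbrs I.G U ⊆ I.β := by
  rintro v ⟨u, hvu, hu⟩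
  rw [hI.mem_β_iff]
  exact fun h => (hI.adj_side v u hvu).mp h (hU hu)

lemma Input.IsTwinFreeBipartite.isIndepSet_of_subset (hI : I.IsTwinFreeBipartite ι)
    {U S : Set (Fin n)} (hU : U ⊆ I.β) (hS : S ⊆ U ∪ I.α \ nbrs I.G U) : I.G.IsIndepSet S := by
  intro v hv u hu _ hvu
  have hside := hI.adj_side v u hvu
  rcases hS hv with h | h <;> rcases hS hu with h' | h'
  · exact (hI.mem_β_iff v).mp (hU h) (hside.mpr ((hI.mem_β_iff u).mp (hU h')))
  · exact h'.2 ⟨v, hvu.symm, h⟩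
  · exact h.2 ⟨u, hvu, h'⟩
  · exact hside.mp h.1 h'.1

/-- If all neighbours of some `v ∈ β \ X` were adjacent to `X`, isolation would make them adjacent
to the same `x ∈ X`, contradicting twin-freeness; so `v` has a surviving neighbour. A node of `α`
has two neighbours, at most one of them in `X`, which gives distance 2 there and 3 everywhere. -/
lemma Input.IsTwinFreeBipartite.isNear_sdiff_nbrs (hI : I.IsTwinFreeBipartite ι)
    {X : Set (Fin n)} (hX : X ⊆ I.β) (hiso : ∀ v ∈ X, ∀ u ∈ X, Walk4 I.G v u → u = v)
    (v : Fin n) : IsNear I.G (I.α \ nbrs I.G X) 3 v := by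
  have h1 : ∀ v ∈ I.β, v ∉ X → IsNear I.G (I.α \ nbrs I.G X) 1 v := by
    intro v hv hvX
    obtain ⟨w, hvw, hw⟩ : ∃ w, I.G.Adj v w ∧ w ∉ nbrs I.G X := by
      by_contra! hall
      obtain ⟨w, hw⟩ := hI.exists_adj v
      obtain ⟨x, hwx, hx⟩ := hall w hw
      obtain ⟨w', hw', hxw'⟩ := hI.twinFree v hv x (hX hx) (fun h => hvX (h ▸ hx))
      obtain ⟨x', hwx', hx'⟩ := hall w' hw'
      obtain rfl := hiso x hx x' hx' ⟨w, hwx.symm, v, hw.symm, w', hw', hwx'⟩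
      exact hxw' hwx'.symm
    have hwα : w ∈ I.α := by
      by_contra h
      exact (hI.mem_β_iff v).mp hv ((hI.adj_side v w hvw).mpr h)
    exact IsNear.of_adj ⟨w, ⟨hwα, hw⟩, by simp⟩ hvw
  have h2 : ∀ v ∈ I.α, IsNear I.G (I.α \ nbrs I.G X) 2 v := by
    intro v hv
    obtain ⟨u, u', hne, hu, hu'⟩ := hI.exists_two_adj v
    have hβ : ∀ u, I.G.Adj v u → u ∈ I.β := fun u hu =>
      (hI.mem_β_iff u).mpr ((hI.adj_side v u hu).mp hv)
    by_cases huX : u ∈ X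
    · refine (h1 u' (hβ u' hu') fun h => ?_).of_adj hu'
      exact hne.symm (hiso u huX u' h (Walk4.of_adj_adj hu.symm hu'))
    · exact (h1 u (hβ u hu) huX).of_adj hu
  by_cases hv : v ∈ I.α
  · exact (h2 v hv).mono subset_rfl (by norm_num)
  · obtain ⟨u, hu⟩ := hI.exists_adj v
    have huα : u ∈ I.α := by
      by_contra h
      exact hv ((hI.adj_side v u hu).mpr h)
    exact (h2 u huα).of_adj hu

/-- Steps alternate between removing nodes of `α` and adding nodes of `β`, so symmetric differences
are independent. Distance 4 is needed for nodes of `β`, which may be that far from `X`; a node of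
`α` that has been removed is within 3 of the new nodes. -/
lemma Input.IsTwinFreeBipartite.isSchedule_growSchedule (hI : I.IsTwinFreeBipartite ι)
    {X : Set (Fin n)} (hX : X ⊆ I.β) (hiso : ∀ v ∈ X, ∀ u ∈ X, Walk4 I.G v u → u = v)
    (hmax : ∀ v ∈ I.β, ∃ u, Walk4 I.G v u ∧ u ∈ X) {d : ℕ} (hd : 4 ≤ d) :
    IsSchedule I.G I.α I.β d 6 (fun i => (growSchedule I.G I.α I.β X).getD i ∅) := by
  have hY : nbrs I.G X ⊆ I.α := hI.nbrs_subset_α hX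
  have hX2 : nbrs I.G (nbrs I.G X) ⊆ I.β := hI.nbrs_subset_β hY
  have hXX2 : X ⊆ nbrs I.G (nbrs I.G X) := by
    intro x hx
    obtain ⟨u, hu⟩ := hI.exists_adj x
    exact ⟨u, hu, x, hu.symm, hx⟩
  have hYY3 : nbrs I.G X ⊆ nbrs I.G (nbrs I.G (nbrs I.G X)) := by
    rintro v ⟨u, hvu, hu⟩
    exact ⟨u, hvu, hXX2 hu⟩
  have hnearX : ∀ v, v ∉ I.α → IsNear I.G X 4 v := by
    intro v hv
    obtain ⟨u, hu, huX⟩ := hmax v ((hI.mem_β_iff v).mpr hv)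
    exact isNear_of_walk4 hu huX
  have hnearX2 : ∀ v, v ∉ I.α → IsNear I.G (nbrs I.G (nbrs I.G X)) 2 v := by
    intro v hv
    obtain ⟨u, ⟨x, h1, y, h2, z, h3, h4⟩, huX⟩ := hmax v ((hI.mem_β_iff v).mpr hv)
    -- The midpoint of the walk to `X` is already in the grown region.
    have hy : y ∈ nbrs I.G (nbrs I.G X) := ⟨z, h3, u, h4, huX⟩
    exact ((isNear_of_mem hy).of_adj h2).of_adj h1
  have hdom : ∀ S, (∀ v, v ∉ I.α → IsNear I.G S 4 v) → (∀ v ∈ I.α, IsNear I.G S 3 v) →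
      IsDominating I.G d S := by
    intro S h h' v
    by_cases hv : v ∈ I.α
    · exact (h' v hv).mono subset_rfl (by omega)
    · exact (h v hv).mono subset_rfl hd
  have hα : ∀ S ⊆ I.α, I.G.IsIndepSet S := fun S hS =>
    hI.isIndepSet_of_subset (U := ∅) (Set.empty_subset _) fun v hv =>
      Or.inr ⟨hS hv, fun ⟨_, _, h⟩ => h⟩
  have hβ : ∀ S ⊆ I.β, I.G.IsIndepSet S := fun S hS =>
    hI.isIndepSet_of_subset hS Set.subset_union_left
  refine ⟨rfl, rfl, ?_, ?_, ?_⟩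
  · intro i h0 h6
    interval_cases i
    · exact hα _ Set.sdiff_subset
    · exact hI.isIndepSet_of_subset hX subset_rfl
    · exact hI.isIndepSet_of_subset hX2 (Set.union_subset_union_left _ hXX2)
    · exact hI.isIndepSet_of_subset hX2 subset_rfl
    · exact hβ _ hX2
  · intro i h0 h6
    interval_cases i
    · exact hdom _ (fun v _ => (hI.isNear_sdiff_nbrs hX hiso v).mono subset_rfl (by norm_num))
        (fun v _ => hI.isNear_sdiff_nbrs hX hiso v)
    · refine hdom _ (fun v hv => (hnearX v hv).mono Set.subset_union_left le_rfl) fun v hv => ?_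
      by_cases h : v ∈ nbrs I.G X
      · obtain ⟨u, hvu, hu⟩ := h
        exact ((isNear_of_mem hu).of_adj hvu).mono Set.subset_union_left (by norm_num)
      · exact ⟨v, Or.inr ⟨hv, h⟩, by simp⟩
    · refine hdom _ (fun v hv => (hnearX v hv).mono Set.subset_union_left le_rfl) fun v hv => ?_
      by_cases h : v ∈ nbrs I.G (nbrs I.G (nbrs I.G X))
      · obtain ⟨u, hvu, w, huw, x, hwx, hx⟩ := h
        exact (((isNear_of_mem hx).of_adj hwx).of_adj huw).of_adj hvu |>.mono
          Set.subset_union_left (by norm_num)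
      · exact ⟨v, Or.inr ⟨hv, h⟩, by simp⟩
    · refine hdom _ (fun v hv => (hnearX2 v hv).mono Set.subset_union_left (by norm_num))
        fun v hv => ?_
      by_cases h : v ∈ nbrs I.G (nbrs I.G (nbrs I.G X))
      · obtain ⟨u, hvu, hu⟩ := h
        exact ((isNear_of_mem hu).of_adj hvu).mono Set.subset_union_left (by norm_num)
      · exact ⟨v, Or.inr ⟨hv, h⟩, by simp⟩
    · refine hdom _ (fun v hv => (hnearX2 v hv).mono subset_rfl (by norm_num)) fun v hv => ?_
      obtain ⟨u, hu⟩ := hI.exists_adj v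
      exact (hnearX2 u ((hI.adj_side v u hu).mp hv)).of_adj hu
  · intro i h6
    interval_cases i
    · refine hα _ fun v hv => ?_
      rcases hv with h | h
      · exact h.1.1
      · exact h.1
    · refine hβ _ fun v hv => ?_
      rcases hv with ⟨h | h, h'⟩ | ⟨h, h'⟩
      · exact hX h
      · exact absurd h h'
      · exact absurd (Or.inr h) h'
    · refine hα _ fun v hv => ?_
      rcases hv with ⟨h | h, h'⟩ | ⟨h | h, h'⟩
      · exact absurd (Or.inl h) h'
      · exact h.1
      · exact absurd (Or.inl h) h'
      · exact h.1
    · refine hβ _ fun v hv => ?_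
      rcases hv with ⟨h | h, h'⟩ | ⟨h | h, h'⟩
      · exact hX2 h
      · exact absurd (Or.inr h) h'
      · exact hX h
      · exact absurd (Or.inr h) h'
    · refine hα _ fun v hv => ?_
      rcases hv with ⟨h, h'⟩ | ⟨h | h, h'⟩
      · exact absurd (Or.inl h) h'
      · exact absurd h h'
      · exact h.1
    · refine hβ _ fun v hv => ?_
      rcases hv with h | h
      · exact h.1
      · exact hX2 h.1

end schedule

/-! ### The fast algorithm -/

open scoped Classical in
lemma isLocal_growSchedule {n T : ℕ} {M : NodeFun n Prop} (hM : IsLocal T M) :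
    IsLocal (T + 3) (fun I ident v =>
      (growSchedule I.G I.α I.β {u | M I ident u}).map fun S => decide (v ∈ S)) := by
  have h0 : IsLocal (T + 3) (fun I ident v => v ∈ {u | M I ident u}) := hM.mono (by omega)
  have h1 : IsLocal (T + 3) (fun I ident v => v ∈ nbrs I.G {u | M I ident u}) :=
    hM.exists_adj.mono (by omega)
  have h2 : IsLocal (T + 3) (fun I ident v => v ∈ nbrs I.G (nbrs I.G {u | M I ident u})) :=
    hM.exists_adj.exists_adj.mono (by omega)
  have h3 : IsLocal (T + 3)
      (fun I ident v => v ∈ nbrs I.G (nbrs I.G (nbrs I.G {u | M I ident u}))) :=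
    hM.exists_adj.exists_adj.exists_adj
  have hα : IsLocal (T + 3) (fun (I : Input n) _ v => v ∈ I.α) := IsLocal.mem_α
  have hβ : IsLocal (T + 3) (fun (I : Input n) _ v => v ∈ I.β) := IsLocal.mem_β
  have hcons {p : NodeFun n Prop} {l : NodeFun n (List Bool)} (hp : IsLocal (T + 3) p)
      (hl : IsLocal (T + 3) l) : IsLocal (T + 3)
        (fun I ident v => decide (p I ident v) :: l I ident v) :=
    hp.comp₂ (fun p l => decide p :: l) hl
  have hd1 := hα.comp₂ (fun p q => p ∧ ¬q) h1
  have hd3 := hα.comp₂ (fun p q => p ∧ ¬q) h3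
  exact hcons hα (hcons hd1 (hcons (h0.comp₂ Or hd1) (hcons (h0.comp₂ Or hd3)
    (hcons (h2.comp₂ Or hd3) (hcons h2 (hcons hβ (IsLocal.const [])))))))

lemma two_le_of_ringInputs_nonempty {r n : ℕ} (h : (ringInputs r n).Nonempty) : 2 ≤ n := by
  obtain ⟨I, m, hm, e, -⟩ := h
  rw [eq_of_equiv_vtx hm e]
  nlinarith [Nat.zero_le (r * m)]

lemma exists_fast_algorithm (r : ℕ) {a d : ℕ} (ha : 1 ≤ a) (hd : 4 ≤ d) :
    ∃ (A : LocalAlgorithm) (T : ℕ → ℕ) (C : ℝ), ∀ n, (ringInputs r n).Nonempty →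
      A.SolvesIn (ringInputs r n) a d 6 (T n) ∧ (T n : ℝ) ≤ C * (logStar n : ℝ) := by
  classical
  let ι := Option (Fin (r + 1))
  obtain ⟨B, hB⟩ := exists_numBits_le (Fintype.card_pos (α := ι × ι × ι × ι)) ha
  choose c hcl hc using fun n => exists_walk4_coloring ι ha n (logStar n - 1)
  choose F hF using fun n => isLocal_growSchedule (isLocal_greedy (hcl n) (2 ^ B))
  -- The decoder depends on `n`, which a node reads off its view. The rounds are spent on colouring,
  -- on `2 ^ B` greedy phases, and on the three neighbourhoods in the schedule.
  refine ⟨fullInfo fun w => F w.size w, fun n => 4 * (logStar n - 1) + 4 * 2 ^ B + 3,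
    7 + 4 * 2 ^ B, fun n hn => ⟨fun I hI ident hid => ?_, ?_⟩⟩
  · have htf := isTwinFreeBipartite_of_mem_ringInputs hI
    obtain ⟨hlt, hne⟩ := hc n I htf ident hid
    have hout : ∀ v, (fullInfo fun w => F w.size w).output
        ((fullInfo fun w => F w.size w).stateAfter I ident
          (4 * (logStar n - 1) + 4 * 2 ^ B + 3) v) =
        (growSchedule I.G I.α I.β {u | greedy (c n) (2 ^ B) I ident u}).map
          fun S => decide (v ∈ S) := by
      intro v
      rw [fullInfo_stateAfter]
      show F (View.size _) _ = _
      rw [view_size]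
      exact (hF n I ident hid.1 v).symm
    refine ⟨6, le_rfl, fun v => by rw [hout]; rfl, ?_⟩
    have hset : (fun i => {v | ((fullInfo fun w => F w.size w).output
        ((fullInfo fun w => F w.size w).stateAfter I ident
          (4 * (logStar n - 1) + 4 * 2 ^ B + 3) v)).getD i false = true}) =
        fun i => (growSchedule I.G I.α I.β {u | greedy (c n) (2 ^ B) I ident u}).getD i ∅ := by
      funext i
      ext v
      rw [Set.mem_ofPred_eq, hout, List.getD_eq_getElem?_getD, List.getD_eq_getElem?_getD,
        List.getElem?_map]
      cases (growSchedule I.G I.α I.β {u | greedy (c n) (2 ^ B) I ident u})[i]? <;> simp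
    rw [hset]
    refine htf.isSchedule_growSchedule (fun v hv => greedy_mem_β hv)
      (fun v hv u hu hvu => greedy_isolated hne _ v u hv hu hvu) (fun v hv => ?_) hd
    exact exists_greedy htf.walk4_self hv ((hlt v).trans_le
      (Nat.pow_le_pow_right (by norm_num) (hB n (two_le_of_ringInputs_nonempty hn))))
  · have hpos : 1 ≤ logStar n := lt_logStar_of_tower_lt (i := 0)
      (by have := two_le_of_ringInputs_nonempty hn; simp only [tower]; omega)
    have hnat : 4 * (logStar n - 1) + 4 * 2 ^ B + 3 ≤ (7 + 4 * 2 ^ B) * logStar n := by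
      have h : (4 * 2 ^ B) * 1 ≤ (4 * 2 ^ B) * logStar n := Nat.mul_le_mul_left _ hpos
      rw [add_mul]
      omega
    exact_mod_cast hnat

/-! ### The lower bound -/

/-- Colour a sequence with the `D + 1` values of `f` at its shifts. If this window were unchanged by
a shift, `f` would be constant along it. -/
lemma le_tower_of_not_const {Y : Type} [Finite Y] {K D N : ℕ} (f : (ℕ → ℕ) → Y)
    (hloc : ∀ s s', (∀ i ≤ K, s i = s' i) → f s = f s')
    (hne : ∀ s, StrictMonoOn s (Set.Iic (K + D)) → (∀ i ≤ K + D, s i < N) →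
      ∃ j ≤ D, f (fun i => s (i + j)) ≠ f s) :
    N ≤ tower (Nat.card (Fin (D + 1) → Y) + (K + D)) := by
  refine le_tower_of_shift_ne (K + D) _ N (Fin (D + 1) → Y)
    (fun s j => f fun i => s (i + j)) (le_tower _) ?_ ?_
  · intro s s' hs
    funext j
    exact hloc _ _ fun i hi => hs _ (by omega)
  · intro s hs hN heq
    obtain ⟨j, hj, hjne⟩ := hne s (hs.mono (Set.Iic_subset_Iic.mpr (by omega)))
      fun i hi => hN i (by omega)
    have hconst : ∀ j ≤ D, f (fun i => s (i + j)) = f s := by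
      intro j
      induction j with
      | zero => exact fun _ => rfl
      | succ j ih =>
        intro hj
        have h := congrFun heq ⟨j, by omega⟩
        simp only [add_assoc] at h
        exact h.symm.trans (ih (by omega))
    exact hjne (hconst j hj)

variable {m r : ℕ}

/-- Blocks are tracked by natural numbers, so that distances can be compared without wrapping around
the ring; `1 ≤ i` keeps `i - 1` from truncating. -/
lemma ringGraph_adj_block {p q : Vtx m r} (h : (ringGraph m r).Adj p q) {i : ℕ}
    (hi : p.1 = (i : ZMod m)) (h1 : 1 ≤ i) :
    ∃ i' : ℕ, q.1 = (i' : ZMod m) ∧ i' ≤ i + 1 ∧ i ≤ i' + 1 := by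
  obtain ⟨o, rfl⟩ := h
  cases o with
  | some j => exact ⟨i, hi, by omega, by omega⟩
  | none =>
    by_cases hs : p.2.1 = true
    · exact ⟨i + 1, by simp [ringNbr, hs, hi], by omega, by omega⟩
    · exact ⟨i - 1, by simp [ringNbr, hs, hi, Nat.cast_sub h1], by omega, by omega⟩

section

variable {n : ℕ} {I : Input n} {e : Fin n ≃ Vtx m r}

lemma IsRing.walk_block (he : IsRing I e) {v u : Fin n} (p : I.G.Walk v u) {i : ℕ}
    (hi : (e v).1 = (i : ZMod m)) (hp : p.length ≤ i) :
    ∃ i' : ℕ, (e u).1 = (i' : ZMod m) ∧ i' ≤ i + p.length ∧ i ≤ i' + p.length := by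
  induction p generalizing i with
  | nil => exact ⟨i, hi, by simp, by simp⟩
  | cons h p ih =>
    rw [SimpleGraph.Walk.length_cons] at hp ⊢
    obtain ⟨i', hi', h1, h2⟩ := ringGraph_adj_block ((he.adj _ _).mp h) hi (by omega)
    obtain ⟨i'', hi'', h3, h4⟩ := ih hi' (by omega)
    exact ⟨i'', hi'', by omega, by omega⟩

/-- No schedule looks the same, at all times, in `2 * d + 1` consecutive blocks. -/
lemma IsRing.not_const_of_isSchedule (he : IsRing I e) {d L : ℕ} {S : ℕ → Set (Fin n)}
    (hS : IsSchedule I.G I.α I.β d L S) {c : ℕ} (hc : ∀ t ≤ L, ∀ s, ∀ i ≤ 2 * d,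
      (∃ j, e.symm (((c + i : ℕ) : ZMod m), s, j) ∈ S t) ↔
        ∃ j, e.symm ((c : ZMod m), s, j) ∈ S t) : False := by
  have hα : ∀ z j, e.symm (z, false, j) ∈ I.α := fun z j => by simp [he.mem_α]
  have hβ : ∀ z j, e.symm (z, true, j) ∈ I.β := fun z j => by simp [he.mem_β]
  have hαβ : ∀ z j, e.symm (z, false, j) ∉ I.β := fun z j => by simp [he.mem_β]
  have hβα : ∀ z j, e.symm (z, true, j) ∉ I.α := fun z j => by simp [he.mem_α]
  have hadj : ∀ z j j', I.G.Adj (e.symm (z, false, j)) (e.symm (z, true, j')) := fun z j j' => by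
    simpa [he.adj] using ringGraph_adj_same_block z false j j'
  have key : ∀ t ≤ L, (¬∃ j, e.symm ((c : ZMod m), true, j) ∈ S t) ∧
      ∃ j, e.symm ((c : ZMod m), false, j) ∈ S t := by
    intro t
    induction t with
    | zero =>
      intro _
      rw [hS.first]
      exact ⟨fun ⟨j, hj⟩ => hβα _ j hj, 0, hα _ 0⟩
    | succ t ih =>
      intro ht
      obtain ⟨h1, j, hj⟩ := ih (by omega)
      -- A new node on the second side is adjacent to the old one on the first side: if the latter
      -- stays, independence fails (at the last time, it would lie in `β`); if it leaves, the step
      -- contains an edge.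
      have htrue : ¬∃ j, e.symm ((c : ZMod m), true, j) ∈ S (t + 1) := by
        rintro ⟨j', hj'⟩
        have hb : e.symm ((c : ZMod m), true, j') ∉ S t := fun h => h1 ⟨j', h⟩
        by_cases ha : e.symm ((c : ZMod m), false, j) ∈ S (t + 1)
        · rcases ht.lt_or_eq with h | h
          · exact hS.indep (t + 1) (by omega) h ha hj' (hadj _ _ _).ne (hadj _ _ _)
          · rw [h, hS.last] at ha
            exact hαβ _ _ ha
        · exact hS.step t (by omega) (Or.inr ⟨hj, ha⟩) (Or.inl ⟨hj', hb⟩) (hadj _ _ _).ne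
            (hadj _ _ _)
      refine ⟨htrue, ?_⟩
      rcases ht.lt_or_eq with h | h
      -- Domination of the middle block `c + d` yields a member in one of the blocks `c, …, c + 2 *
      -- d`; constancy carries its side back to block `c`.
      · obtain ⟨u, hu, hd⟩ := hS.dominating (t + 1) (by omega) h
          (e.symm (((c + d : ℕ) : ZMod m), true, 0))
        obtain ⟨p, hp⟩ := SimpleGraph.exists_walk_of_edist_ne_top
          (hd.trans_lt (ENat.natCast_lt_top d)).ne
        have hpd : p.length ≤ d := by
          rw [← hp] at hd
          exact_mod_cast hd
        obtain ⟨i, hi, h3, h4⟩ := he.walk_block p (i := c + d) (by simp) (by omega)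
        obtain ⟨i, rfl⟩ : ∃ i', i = c + i' := ⟨i - c, by omega⟩
        have hu' : ∃ j, e.symm (((c + i : ℕ) : ZMod m), (e u).2.1, j) ∈ S (t + 1) :=
          ⟨(e u).2.2, by rw [← hi]; simpa using hu⟩
        rw [hc (t + 1) ht _ i (by omega)] at hu'
        cases hs : (e u).2.1
        · rwa [hs] at hu'
        · rw [hs] at hu'
          exact absurd hu' htrue
      · rw [h, hS.last] at htrue
        exact absurd ⟨0, hβ _ 0⟩ htrue
  have h := (key L le_rfl).1
  rw [hS.last] at h
  exact h ⟨0, hβ _ 0⟩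

/-- The identifiers obtained from a numbering of the blocks. -/
def blockIdent (e : Fin n ≃ Vtx m r) (x : ZMod m → ℕ) (v : Fin n) : ℕ :=
  2 * (r + 1) * x (e v).1 + (2 * (e v).2.2 + (e v).2.1.toNat) + 1

lemma blockIdent_injective (e : Fin n ≃ Vtx m r) {x : ZMod m → ℕ} (hx : Function.Injective x) :
    Function.Injective (blockIdent e x) := by
  have hdiv : ∀ y b, b < 2 * (r + 1) → (2 * (r + 1) * y + b) / (2 * (r + 1)) = y := by
    intro y b hb
    rw [Nat.mul_add_div (by omega), Nat.div_eq_of_lt hb, add_zero]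
  intro v u h
  have hlt : ∀ v, 2 * ((e v).2.2 : ℕ) + (e v).2.1.toNat < 2 * (r + 1) := by
    intro v
    have h1 := (e v).2.2.isLt
    have h2 := Bool.toNat_le (e v).2.1
    omega
  have h' := Nat.succ_injective h
  have hblock : x (e v).1 = x (e u).1 := by
    rw [← hdiv (x (e v).1) _ (hlt v), h', hdiv _ _ (hlt u)]
  rw [hblock] at h'
  have h1 := Nat.add_left_cancel h'
  have h2 := Bool.toNat_le (e v).2.1
  have h3 := Bool.toNat_le (e u).2.1
  refine e.injective (Prod.ext (hx hblock) (Prod.ext ?_ (Fin.ext (by omega))))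
  have h4 : (e v).2.1.toNat = (e u).2.1.toNat := by omega
  cases hv : (e v).2.1 <;> cases hu : (e u).2.1 <;> simp_all

lemma isIdentAssignment_blockIdent (hm : 3 ≤ m) (e : Fin n ≃ Vtx m r) {x : ZMod m → ℕ}
    (hx : Function.Injective x) (hlt : ∀ z, x z < m) {a : ℕ} (ha : 1 ≤ a) :
    IsIdentAssignment n a (blockIdent e x) := by
  refine ⟨blockIdent_injective e hx, fun v => ⟨by simp [blockIdent], ?_⟩⟩
  refine le_trans ?_ (Nat.le_self_pow (by omega) n)
  refine le_trans ?_ (eq_of_equiv_vtx hm e).ge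
  rw [blockIdent]
  have h1 : 2 * (r + 1) * (x (e v).1 + 1) ≤ 2 * (r + 1) * m := Nat.mul_le_mul_left _ (hlt _)
  have h2 := (e v).2.2.isLt
  have h3 := Bool.toNat_le (e v).2.1
  rw [mul_add] at h1
  omega

/-- What the output looks like in one block: for each time and each side, whether the set at that
time contains a node from that side. -/
def blockOutput (A : LocalAlgorithm) (I : Input n) (e : Fin n ≃ Vtx m r) (ℓ T : ℕ)
    (x : ZMod m → ℕ) (z : ZMod m) : Set (Fin (ℓ + 1) × Bool) :=
  {p | ∃ j, (A.output (A.stateAfter I (blockIdent e x) T (e.symm (z, p.2, j)))).getD p.1 false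
    = true}

/-- The permutation of the nodes that moves each node by `c` blocks. -/
def shiftPerm (e : Fin n ≃ Vtx m r) (c : ZMod m) : Equiv.Perm (Fin n) :=
  e.trans (((Equiv.addRight c).prodCongr (Equiv.refl _)).trans e.symm)

lemma apply_shiftPerm (e : Fin n ≃ Vtx m r) (c : ZMod m) (v : Fin n) :
    e (shiftPerm e c v) = ((e v).1 + c, (e v).2) := by
  simp [shiftPerm, Prod.map]

lemma ringGraph_adj_shift (p q : Vtx m r) (c : ZMod m) :
    (ringGraph m r).Adj (p.1 + c, p.2) (q.1 + c, q.2) ↔ (ringGraph m r).Adj p q := by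
  refine exists_congr fun o => ?_
  obtain ⟨i, s, j⟩ := p
  obtain ⟨i', s', j'⟩ := q
  cases o <;> cases s <;>
    simp [ringNbr, add_right_comm i c 1, add_sub_right_comm]

lemma IsRing.blockOutput_eq (he : IsRing I e) (A : LocalAlgorithm) (ℓ T c : ℕ)
    {x x' : ZMod m → ℕ} (hx : Function.Injective x) (hx' : Function.Injective x')
    (h : ∀ i : ℕ, i ≤ 2 * T → x' (((i + c : ℕ) : ZMod m)) = x (i : ZMod m)) :
    blockOutput A I e ℓ T x (T : ZMod m) = blockOutput A I e ℓ T x' ((T + c : ℕ) : ZMod m) := by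
  have key := A.stateAfter_eq_of_agree I (blockIdent_injective e hx) (blockIdent_injective e hx')
    (shiftPerm e (c : ZMod m))
    (fun u v => by rw [he.adj, he.adj, apply_shiftPerm, apply_shiftPerm, ringGraph_adj_shift])
    (fun v => by rw [he.mem_α, he.mem_α, apply_shiftPerm])
    (fun v => by rw [he.mem_β, he.mem_β, apply_shiftPerm])
    -- The known arc, blocks `t` to `2 * T - t`, shrinks by one block at each end per round, down to
    -- block `T`.
    (fun t v => ∃ i : ℕ, (e v).1 = (i : ZMod m) ∧ t ≤ i ∧ i + t ≤ 2 * T)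
    (fun t v ⟨i, hi, h1, h2⟩ => ⟨i, hi, by omega, by omega⟩)
    (fun t v u ⟨i, hi, h1, h2⟩ hvu => by
      obtain ⟨i', hi', h3, h4⟩ := ringGraph_adj_block ((he.adj v u).mp hvu) hi (by omega)
      exact ⟨i', hi', by omega, by omega⟩)
    (fun t v ⟨i, hi, h1, h2⟩ => by
      have hx := h i (by omega)
      push_cast at hx
      simp only [blockIdent, apply_shiftPerm, hi, hx]) T
  ext p
  refine exists_congr fun j => ?_
  have hshift : shiftPerm e (c : ZMod m) (e.symm ((T : ZMod m), p.2, j)) =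
      e.symm (((T + c : ℕ) : ZMod m), p.2, j) := by
    apply e.injective
    rw [apply_shiftPerm]
    simp
  rw [key _ ⟨T, by simp, le_rfl, by omega⟩, hshift]

/-- Monotonicity forces `i ≤ s i < m`, so the blocks `0, …, M` are distinct, and a partial injection
between sets of size `m` extends to a bijection. -/
lemma exists_injective_extension (hm : 3 ≤ m) {M : ℕ} {s : ℕ → ℕ}
    (hs : StrictMonoOn s (Set.Iic M)) (hlt : ∀ i ≤ M, s i < m) :
    ∃ x : ZMod m → ℕ, Function.Injective x ∧ (∀ z, x z < m) ∧
      ∀ i : ℕ, i ≤ M → x (i : ZMod m) = s i := by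
  have : NeZero m := ⟨by omega⟩
  have hle : ∀ i ≤ M, i ≤ s i := by
    intro i
    induction i with
    | zero => exact fun _ => Nat.zero_le _
    | succ i ih =>
      intro hi
      exact (ih (by omega)).trans_lt (hs (by simp; omega) (by simpa using hi) (by omega))
  have hval : ∀ i ≤ M, ((i : ℕ) : ZMod m).val = i := fun i hi =>
    ZMod.val_natCast_of_lt ((hle i hi).trans_lt (hlt i hi))
  obtain ⟨g, hg⟩ := Set.MapsTo.exists_equiv_extend_of_card_eq (α := ZMod m)
    (t := Finset.range m) (by simp [ZMod.card]) (s := (fun i : ℕ => (i : ZMod m)) '' Set.Iic M)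
    (f := fun z => s z.val) (by
      rintro _ ⟨i, hi, rfl⟩
      simpa [hval i hi] using hlt i hi) (by
      rintro _ ⟨i, hi, rfl⟩ _ ⟨i', hi', rfl⟩ h
      simp only [hval i hi, hval i' hi'] at h
      rw [hs.injOn hi hi' h])
  refine ⟨fun z => g z, Subtype.val_injective.comp g.injective,
    fun z => Finset.mem_range.mp (g z).2, fun i hi => ?_⟩
  exact (hg _ ⟨i, hi, rfl⟩).trans (by rw [hval i hi])

lemma IsRing.le_tower_of_solvesIn (hm : 3 ≤ m) (he : IsRing I e) {A : LocalAlgorithm}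
    {𝒞 : Set (Input n)} (hI : I ∈ 𝒞) {a d ℓ T : ℕ} (ha : 1 ≤ a) (hA : A.SolvesIn 𝒞 a d ℓ T) :
    m ≤ tower (Nat.card (Fin (2 * d + 1) → Set (Fin (ℓ + 1) × Bool)) + (2 * T + 2 * d)) := by
  classical
  let P : (ℕ → ℕ) → (ZMod m → ℕ) → Prop := fun s x =>
    Function.Injective x ∧ ∀ i : ℕ, i ≤ 2 * T → x (i : ZMod m) = s i
  -- The pattern of block `T` under any numbering satisfying `Q`. For `Q = P s` the choice is
  -- immaterial by `blockOutput_eq`, and making `F` a function of the predicate yields dependence on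
  -- the first `2 * T + 1` entries only.
  let F : ((ZMod m → ℕ) → Prop) → Set (Fin (ℓ + 1) × Bool) := fun Q =>
    if h : ∃ x, Q x then blockOutput A I e ℓ T h.choose (T : ZMod m) else ∅
  have hF : ∀ (s : ℕ → ℕ) (x : ZMod m → ℕ) (c : ℕ), Function.Injective x →
      (∀ i : ℕ, i ≤ 2 * T → x ((i + c : ℕ) : ZMod m) = s (i + c)) →
      F (P fun i => s (i + c)) = blockOutput A I e ℓ T x ((T + c : ℕ) : ZMod m) := by
    intro s x c hx hxs
    have hex : ∃ y, P (fun i => s (i + c)) y :=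
      ⟨fun z => x (z + c), hx.comp (add_left_injective _), fun i hi => by
        have h := hxs i hi
        push_cast at h
        exact h⟩
    simp only [F, dif_pos hex]
    exact he.blockOutput_eq A ℓ T c hex.choose_spec.1 hx fun i hi =>
      (hxs i hi).trans (hex.choose_spec.2 i hi).symm
  refine le_tower_of_not_const (fun s => F (P s)) ?_ ?_
  · intro s s' hs
    refine congrArg F (funext fun x => propext (and_congr_right' (forall₂_congr fun i hi => ?_)))
    rw [hs i hi]
  · intro s hs hlt
    by_contra! hconst
    obtain ⟨x, hx, hxm, hxs⟩ := exists_injective_extension hm hs hlt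
    obtain ⟨L, hL, -, hS⟩ := hA I hI _ (isIdentAssignment_blockIdent hm e hx hxm ha)
    have hout : ∀ j ≤ 2 * d, blockOutput A I e ℓ T x ((T + j : ℕ) : ZMod m) =
        blockOutput A I e ℓ T x (T : ZMod m) := by
      intro j hj
      have h0 := hF s x 0 hx fun i hi => hxs _ (by omega)
      rw [← hF s x j hx fun i hi => hxs _ (by omega)]
      exact (hconst j hj).trans h0
    refine he.not_const_of_isSchedule hS (c := T) fun t ht b i hi => ?_
    exact Set.ext_iff.mp (hout i hi) (⟨t, by omega⟩, b)

end

lemma exists_lower_bound (r : ℕ) {a d : ℕ} (ℓ : ℕ) (ha : 1 ≤ a) :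
    ∃ (c : ℝ) (n₀ : ℕ), 0 < c ∧ ∀ (A : LocalAlgorithm) (n T : ℕ), n₀ ≤ n →
      (ringInputs r n).Nonempty → A.SolvesIn (ringInputs r n) a d ℓ T →
        c * (logStar n : ℝ) ≤ (T : ℝ) := by
  set Q := Nat.card (Fin (2 * d + 1) → Set (Fin (ℓ + 1) × Bool)) + 2 * d + 2 * (r + 1)
  -- From `logStar n ≤ 2 * T + Q`, and `2 * Q < logStar n` for these `n`, it follows that `logStar n
  -- ≤ 4 * T`.
  refine ⟨1 / 4, tower (2 * Q) + 1, by norm_num, ?_⟩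
  rintro A n T hn ⟨I, m, hm, e, he⟩ hA
  have h1 := he.le_tower_of_solvesIn hm (𝒞 := ringInputs r n) ⟨m, hm, e, he⟩ ha hA
  have h2 : n ≤ tower (2 * T + Q) := by
    calc n = 2 * (r + 1) * m := eq_of_equiv_vtx hm e
      _ ≤ 2 * (r + 1) * tower _ := Nat.mul_le_mul_left _ h1
      _ ≤ tower (_ + 2 * (r + 1)) := mul_tower_le _ _
      _ = tower (2 * T + Q) := congrArg tower (by omega)
  have h3 := logStar_le_of_le_tower h2
  have h4 : 2 * Q < logStar n := lt_logStar_of_tower_lt (by omega)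
  have h5 : logStar n ≤ 4 * T := by omega
  have h6 : (logStar n : ℝ) ≤ 4 * T := by exact_mod_cast h5
  linarith

end MISReconf

theorem mainTheorem8 (k d : ℕ) (hk : 2 ≤ k) (hd : 4 ≤ d) :
    ∃ 𝒞 : (n : ℕ) → Set (MISReconf.Input n),
      (∀ n, ∀ I ∈ 𝒞 n, I.IsConnectedRegular k) ∧
      {n : ℕ | (𝒞 n).Nonempty}.Infinite ∧
      (∃ ℓ : ℕ, ∀ a : ℕ, 1 ≤ a →
        ∃ (A : MISReconf.LocalAlgorithm) (T : ℕ → ℕ) (C : ℝ), ∀ n, (𝒞 n).Nonempty →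
          A.SolvesIn (𝒞 n) a d ℓ (T n) ∧ (T n : ℝ) ≤ C * (logStar n : ℝ)) ∧
      (∀ ℓ a : ℕ, 1 ≤ a →
        ∃ (c : ℝ) (n₀ : ℕ), 0 < c ∧
          ∀ (A : MISReconf.LocalAlgorithm) (n T : ℕ), n₀ ≤ n → (𝒞 n).Nonempty →
            A.SolvesIn (𝒞 n) a d ℓ T → c * (logStar n : ℝ) ≤ (T : ℝ)) := by
  obtain ⟨r, rfl⟩ : ∃ r, k = r + 2 := ⟨k - 2, by omega⟩
  exact ⟨MISReconf.ringInputs r, fun _ _ hI => MISReconf.isConnectedRegular_of_mem_ringInputs hI,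
    MISReconf.infinite_ringInputs_nonempty r,
    ⟨6, fun _ ha => MISReconf.exists_fast_algorithm r ha hd⟩,
    fun ℓ _ ha => MISReconf.exists_lower_bound r ℓ ha⟩
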